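/- **Theorem (Uniform consistency of MLEs).** For integers $1\le n\le m$ and $1\le d\le m$, let $\mathcal B(n,m,d)$ be the random bipartite graph with $n$ left and $m$ right vertices (together the $n+m$ subjects) in which each left vertex is linked, independently of the others, to a uniformly random set of $d$ different right vertices. Let $\boldsymbol u\in\mathbb R^{n+m}$ be a merit vector, normalized by $u_1=0$. Independently of the graph and of each other, each linked pair of a left vertex $i$ and a right vertex $j$ is compared once: $i$ beats $j$ with probability $f(u_i-u_j)$, where $f(x)=\frac1{1+e^{-x}}$, and otherwise $j$ beats $i$. Let $A'_{ij}\in\{0,1\}$ be the number of times that $i$ beats $j$, and let $\mathcal L(\boldsymbol v)=\sum_{i\ne j}A'_{ij}\log f(v_i-v_j)$ be the log-likelihood. A maximum likelihood estimator (MLE) $\boldsymbol u^*$ is a maximizer of $\mathcal L$ over $\mathbb R^{n+m}$, normalized by $u^*_1=0$. Put $\alpha=\max_{i,j}(u_i-u_j)$ and $$\Delta_{n,m}=\sqrt{\frac{m\log^3(n+m)}{n\,d\,\log^2\!\left(\frac nm d\right)}}\qquad(nd\ne m).$$ Consider any sequence of such models, with parameters $n=n_k\le m=m_k$, $1\le d=d_k\le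 m_k$, $n_kd_k\neq m_k$, and merit vectors $\boldsymbol u=\boldsymbol u^{(k)}$, such that $n_k\to\infty$ and $m_k\to\infty$ as $k\to\infty$. If $$\exp\bigl(2(\alpha_k+1)\bigr)\,\Delta_{n_k,m_k}\to0\qquad(k\to\infty),$$ where $\alpha_k$ and $\Delta_{n_k,m_k}$ are formed from $n_k,m_k,d_k,\boldsymbol u^{(k)}$, then the MLE is uniformly consistent: $\|\boldsymbol u^*-\boldsymbol u\|_\infty\to0$ in probability. That is, for every $\varepsilon>0$, the probability that the MLE $\boldsymbol u^*$ exists, is unique and satisfies $\|\boldsymbol u^*-\boldsymbol u\|_\infty\le\varepsilon$ tends to $1$. -/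

import Mathlib

open MeasureTheory ProbabilityTheory Filter Topology

noncomputable section

namespace Rasch

/-- The subjects: `n` left vertices (students) and `m` right vertices (questions). -/
abbrev Subject (n m : ℕ) : Type := Fin n ⊕ Fin m

/-- A bipartite task assignment graph, given by the set of right neighbours of each left vertex. -/
abbrev Assignment (n m : ℕ) : Type := Fin n → Finset (Fin m)

/-- Answers: `w (i, j) = true` means that left vertex `i` beats right vertex `j` (a correct answer).
Only the answers on the edges of the task assignment graph are observed. -/
abbrev Answers (n m : ℕ) : Type := Fin n × Fin m → Bool

/-- The random bipartite graph `B(n, m, d)`: each left vertex is independently linked to a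
uniformly random set of `d` different right vertices. -/
def assignmentLaw (n m d : ℕ) : Measure (Assignment n m) :=
  Measure.pi fun _ : Fin n => uniformOn {J : Finset (Fin m) | J.card = d}

/-- Independent Bernoulli answers; left vertex `i` beats right vertex `j` with probability
`1 / (1 + exp (-(u i - u j)))`. -/
def answersLaw {n m : ℕ} (u : Subject n m → ℝ) : Measure (Answers n m) :=
  Measure.pi fun e : Fin n × Fin m =>
    bernoulliMeasure true false (unitInterval.sigmoid (u (Sum.inl e.1) - u (Sum.inr e.2)))

/-- The joint law of the task assignment graph and of the answers, which are independent. -/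
def examLaw {n m : ℕ} (d : ℕ) (u : Subject n m → ℝ) : Measure (Assignment n m × Answers n m) :=
  (assignmentLaw n m d).prod (answersLaw u)

/-- The adjacency matrix of the exam result graph: `beats ω a b` is the number (0 or 1) of times
that subject `a` beats subject `b`. -/
def beats {n m : ℕ} (ω : Assignment n m × Answers n m) : Subject n m → Subject n m → ℕ
  | Sum.inl i, Sum.inr j => if j ∈ ω.1 i ∧ ω.2 (i, j) = true then 1 else 0
  | Sum.inr j, Sum.inl i => if j ∈ ω.1 i ∧ ω.2 (i, j) = false then 1 else 0
  | Sum.inl _, Sum.inl _ => 0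
  | Sum.inr _, Sum.inr _ => 0

/-- The log-likelihood of the merit vector `v`, given the exam result graph. -/
def logLikelihood {n m : ℕ} (ω : Assignment n m × Answers n m) (v : Subject n m → ℝ) : ℝ :=
  ∑ a, ∑ b ∈ Finset.univ.erase a, (beats ω a b : ℝ) * Real.log (Real.sigmoid (v a - v b))

/-- `v` is a maximum likelihood estimate of the merit vector, normalized to vanish at the reference
subject `r`. The log-likelihood is invariant under adding a constant to all merits. -/
def IsMLE {n m : ℕ} (ω : Assignment n m × Answers n m) (r : Subject n m) (v : Subject n m → ℝ) :
    Prop :=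
  v r = 0 ∧ ∀ v' : Subject n m → ℝ, logLikelihood ω v' ≤ logLikelihood ω v

/-- The largest difference between two merits. -/
def meritRange {n m : ℕ} (u : Subject n m → ℝ) : ℝ :=
  ⨆ p : Subject n m × Subject n m, (u p.1 - u p.2)

/-- The quantity `Δ_{n,m}` for left degree `d`. It is meaningful if `n d ≠ 0` and `n d ≠ m`. -/
def delta (n m d : ℕ) : ℝ :=
  Real.sqrt ((m * Real.log (n + m) ^ 3) / (n * d * Real.log (n / m * d) ^ 2))

end Rasch

end

noncomputable section

namespace Rasch

variable {n m : ℕ}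

/-! Write σ for the logistic function, L = log(n+m), λ = nd/m for `meanDegree`, and δ = v - u for
the error of a candidate v. The differences F a b = σ(v a - v b) - σ(u a - u b) form an
antisymmetric flow along the edges. Downhill for δ the flow is at least c = e^{-(α+1)}/4 times the
drop of δ, as long as the merit ranges of u and v are at most α+1. Its divergence at a is `score ω u
a - score ω v a` (`score_sub_score`). The score of an MLE vanishes, so the divergence is then pure
noise, which Hoeffding's inequality bounds by √(L · degree) at all subjects simultaneously.

On an expander such a flow forces δ to be nearly constant (`sub_le_of_flow`). Let U_k be the level
set δ ≥ δ a₀ - k t. The divergence summed over U_k pays for every edge from U_k to the complement of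
U_{k+1}, and each of these carries at least c t. Hence at most 1/30 of the total degree of U_k skips
a level, and the larger of the densities of U_k on the two sides grows by a factor λ/(70L) per level
until it reaches 3/5. After K+1 levels, with K about 2L/log λ, the level set has 3/5 of the left
vertices. The same holds from below, two such sets meet, and so δ oscillates by at most 2(K+1)t.
With t of order e^{α+1}√(L/λ) this is of order e^{α+1}Δ.

The lower bound on F needs prior control of v. Therefore the argument is run on the maximizer under
the constraint that δ oscillates by at most ε ≤ 1 (`exists_constrained_maximizer`), whose first
order inequalities still bound the divergence on the side that matters. The oscillation turns out to
be less than ε, so the constraint is inactive, the score vanishes, and by concavity v is an MLE.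
Uniqueness is the same flow argument for two MLEs, with divergence zero.

The graph is an expander with high probability (`assignmentLaw_not_isExpander_le`) by Chernoff
bounds for edge counts and a union bound over all pairs of vertex sets. -/

/-! ### Estimates for the logistic function -/

theorem exp_neg_div_four_le_sigmoid_mul {R z : ℝ} (hz : |z| ≤ R) :
    Real.exp (-R) / 4 ≤ Real.sigmoid z * (1 - Real.sigmoid z) := by
  rw [← Real.sigmoid_neg, Real.sigmoid_def, Real.sigmoid_def, neg_neg, ← mul_inv, Real.exp_neg,
    div_eq_mul_inv, ← mul_inv]
  have h0 : (0 : ℝ) ≤ R := (abs_nonneg z).trans hz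
  have h1 : Real.exp z ≤ Real.exp R := Real.exp_le_exp.2 ((le_abs_self z).trans hz)
  have h2 : Real.exp (-z) ≤ Real.exp R := Real.exp_le_exp.2 ((neg_le_abs z).trans hz)
  have h3 : Real.exp (-z) * Real.exp z = 1 := by rw [← Real.exp_add]; simp
  have h4 : 1 ≤ Real.exp R := Real.one_le_exp h0
  apply inv_anti₀ (by positivity)
  nlinarith

theorem exp_neg_div_four_mul_sub_le_sigmoid_sub {R x y : ℝ} (hx : |x| ≤ R) (hy : |y| ≤ R)
    (hyx : y ≤ x) :
    Real.exp (-R) / 4 * (x - y) ≤ Real.sigmoid x - Real.sigmoid y := by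
  refine (convex_Icc (-R) R).mul_sub_le_image_sub_of_le_deriv
    continuous_sigmoid.continuousOn
    differentiable_sigmoid.differentiableOn ?_ y (abs_le.1 hy) x (abs_le.1 hx) hyx
  intro z hz
  rw [Real.deriv_sigmoid]
  exact exp_neg_div_four_le_sigmoid_mul (abs_le.2 (Set.mem_Icc.1 (interior_subset hz)))

theorem hasDerivAt_log_sigmoid (x : ℝ) :
    HasDerivAt (fun x => Real.log (Real.sigmoid x)) (1 - Real.sigmoid x) x := by
  have h := (Real.hasDerivAt_sigmoid x).log (Real.sigmoid_pos x).ne'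
  rwa [mul_div_cancel_left₀ _ (Real.sigmoid_pos x).ne'] at h

/-- Concavity of log σ, from Jensen's inequality for `exp` at the points 0 and x - y with weights
σ(x) and 1 - σ(x): the weighted mean of the exponentials is exactly σ(x)/σ(y). -/
theorem log_sigmoid_le_tangent (x y : ℝ) :
    Real.log (Real.sigmoid y) ≤
      Real.log (Real.sigmoid x) + (1 - Real.sigmoid x) * (y - x) := by
  have hx := Real.sigmoid_pos x
  have hy := Real.sigmoid_pos y
  have key : Real.exp ((1 - Real.sigmoid x) * (-(y - x))) ≤
      Real.sigmoid x + (1 - Real.sigmoid x) * Real.exp (-(y - x)) := by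
    have := convexOn_exp.2 (Set.mem_univ (0 : ℝ)) (Set.mem_univ (-(y - x)))
      hx.le (sub_nonneg.2 (Real.sigmoid_le_one x)) (by ring)
    simpa using this
  have h2 : Real.sigmoid x + (1 - Real.sigmoid x) * Real.exp (-(y - x)) =
      Real.sigmoid x / Real.sigmoid y := by
    have e : Real.exp (-(y - x)) = Real.exp (-y) * Real.exp x := by rw [← Real.exp_add]; ring_nf
    have e' : Real.exp (-x) = (Real.exp x)⁻¹ := Real.exp_neg x
    have := Real.exp_pos x
    rw [e, Real.sigmoid_def, Real.sigmoid_def, e']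
    field_simp
    ring
  rw [h2] at key
  have h3 := Real.log_le_log (Real.exp_pos _) key
  rw [Real.log_exp, Real.log_div hx.ne' hy.ne'] at h3
  linarith

/-! ### Score and concavity of the log-likelihood -/

/-- The adjacency matrix of a task assignment graph, with entries `0` and `1`. -/
def link (G : Assignment n m) : Subject n m → Subject n m → ℝ
  | Sum.inl i, Sum.inr j => if j ∈ G i then 1 else 0
  | Sum.inr j, Sum.inl i => if j ∈ G i then 1 else 0
  | Sum.inl _, Sum.inl _ => 0
  | Sum.inr _, Sum.inr _ => 0

/-- The degree of a subject in the task assignment graph. -/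
def degree (G : Assignment n m) (a : Subject n m) : ℝ := ∑ b, link G a b

/-- The partial derivative of the log-likelihood in the merit of the subject `a`. -/
def score (ω : Assignment n m × Answers n m) (v : Subject n m → ℝ) (a : Subject n m) : ℝ :=
  ∑ b, ((beats ω a b : ℝ) - link ω.1 a b * Real.sigmoid (v a - v b))

theorem link_comm (G : Assignment n m) (a b : Subject n m) : link G a b = link G b a := by
  rcases a with i | j <;> rcases b with i' | j' <;> rfl

theorem link_nonneg (G : Assignment n m) (a b : Subject n m) : 0 ≤ link G a b := by
  rcases a with i | j <;> rcases b with i' | j' <;> simp only [link] <;> positivity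

theorem beats_add_beats (ω : Assignment n m × Answers n m) (a b : Subject n m) :
    (beats ω a b : ℝ) + beats ω b a = link ω.1 a b := by
  rcases a with i | j <;> rcases b with i' | j' <;> simp only [link, beats]
  · simp
  · by_cases h : j' ∈ ω.1 i <;> cases h' : ω.2 (i, j') <;> simp [h]
  · by_cases h : j ∈ ω.1 i' <;> cases h' : ω.2 (i', j) <;> simp [h]
  · simp

theorem beats_self (ω : Assignment n m × Answers n m) (a : Subject n m) : beats ω a a = 0 := by
  rcases a with i | j <;> rfl

theorem logLikelihood_eq (ω : Assignment n m × Answers n m) (v : Subject n m → ℝ) :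
    logLikelihood ω v = ∑ a, ∑ b, (beats ω a b : ℝ) * Real.log (Real.sigmoid (v a - v b)) := by
  unfold logLikelihood
  refine Finset.sum_congr rfl fun a _ => ?_
  apply Finset.sum_erase
  simp [beats_self]

/-- Summation by parts: the linear part of the log-likelihood is given by the score. -/
theorem sum_beats_mul_eq_sum_score (ω : Assignment n m × Answers n m)
    (v h : Subject n m → ℝ) :
    ∑ a, ∑ b, (beats ω a b : ℝ) * ((1 - Real.sigmoid (v a - v b)) * (h a - h b)) =
      ∑ a, score ω v a * h a := by
  have e1 : ∑ a, ∑ b, (beats ω a b : ℝ) * ((1 - Real.sigmoid (v a - v b)) * (h a - h b)) =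
      ∑ a, ∑ b, (beats ω a b : ℝ) * (1 - Real.sigmoid (v a - v b)) * h a -
      ∑ a, ∑ b, (beats ω b a : ℝ) * (1 - Real.sigmoid (v b - v a)) * h a := by
    rw [Finset.sum_comm (f := fun a b => (beats ω b a : ℝ) * _ * h a), ← Finset.sum_sub_distrib]
    refine Finset.sum_congr rfl fun a _ => ?_
    rw [← Finset.sum_sub_distrib]
    exact Finset.sum_congr rfl fun b _ => by ring
  rw [e1, ← Finset.sum_sub_distrib]
  refine Finset.sum_congr rfl fun a _ => ?_
  rw [← Finset.sum_sub_distrib, score, Finset.sum_mul]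
  refine Finset.sum_congr rfl fun b _ => ?_
  have : v b - v a = -(v a - v b) := by ring
  rw [← beats_add_beats, this, Real.sigmoid_neg]
  ring

theorem logLikelihood_le_tangent (ω : Assignment n m × Answers n m) (v v' : Subject n m → ℝ) :
    logLikelihood ω v' ≤ logLikelihood ω v + ∑ a, score ω v a * (v' a - v a) := by
  rw [← sum_beats_mul_eq_sum_score ω v (fun a => v' a - v a), logLikelihood_eq, logLikelihood_eq,
    ← Finset.sum_add_distrib]
  refine Finset.sum_le_sum fun a _ => ?_
  rw [← Finset.sum_add_distrib]
  refine Finset.sum_le_sum fun b _ => ?_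
  rw [← mul_add]
  refine mul_le_mul_of_nonneg_left ?_ (Nat.cast_nonneg _)
  have e : v' a - v a - (v' b - v b) = v' a - v' b - (v a - v b) := by ring
  rw [e]
  exact log_sigmoid_le_tangent (v a - v b) (v' a - v' b)

theorem hasDerivAt_logLikelihood (ω : Assignment n m × Answers n m) (v h : Subject n m → ℝ) :
    HasDerivAt (fun s : ℝ => logLikelihood ω (v + s • h)) (∑ a, score ω v a * h a) 0 := by
  rw [← sum_beats_mul_eq_sum_score]
  simp_rw [logLikelihood_eq]
  refine HasDerivAt.fun_sum fun a _ => HasDerivAt.fun_sum fun b _ => HasDerivAt.const_mul _ ?_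
  have h1 : HasDerivAt (fun s : ℝ => (v + s • h) a - (v + s • h) b) (h a - h b) 0 := by
    have : (fun s : ℝ => (v + s • h) a - (v + s • h) b) =
        fun s => (v a - v b) + s * (h a - h b) := by
      funext s; simp; ring
    rw [this]
    simpa using ((hasDerivAt_id (0 : ℝ)).mul_const (h a - h b)).const_add (v a - v b)
  have h2 := hasDerivAt_log_sigmoid ((v + (0 : ℝ) • h) a - (v + (0 : ℝ) • h) b)
  have h3 := HasDerivAt.comp (0 : ℝ) h2 h1
  simpa [Function.comp_def] using h3

/-- A one-sided directional derivative at a maximum is not positive. -/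
theorem sum_score_mul_nonpos_of_forall_le {ω : Assignment n m × Answers n m}
    {v h : Subject n m → ℝ} {s₀ : ℝ} (hs₀ : 0 < s₀)
    (H : ∀ s, 0 ≤ s → s ≤ s₀ → logLikelihood ω (v + s • h) ≤ logLikelihood ω v) :
    ∑ a, score ω v a * h a ≤ 0 := by
  have h1 := (hasDerivAt_logLikelihood ω v h).hasDerivWithinAt (s := Set.Ioi 0)
  rw [hasDerivWithinAt_iff_tendsto_slope' (by simp)] at h1
  refine le_of_tendsto h1 ?_
  filter_upwards [Ioo_mem_nhdsGT hs₀] with s hs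
  rw [slope_def_field]
  apply div_nonpos_of_nonpos_of_nonneg
  · simpa using H s hs.1.le hs.2.le
  · linarith [hs.1]

theorem sum_score_mul_single (ω : Assignment n m × Answers n m) (v : Subject n m → ℝ)
    (a : Subject n m) (c : ℝ) :
    ∑ b, score ω v b * (Pi.single a c : Subject n m → ℝ) b = score ω v a * c := by
  simp [Pi.single_apply]

theorem score_eq_zero_of_isMLE {ω : Assignment n m × Answers n m} {r : Subject n m}
    {v : Subject n m → ℝ} (hv : IsMLE ω r v) (a : Subject n m) : score ω v a = 0 := by
  have h1 := sum_score_mul_nonpos_of_forall_le (h := Pi.single a 1) one_pos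
    fun s _ _ => hv.2 (v + s • Pi.single a 1)
  have h2 := sum_score_mul_nonpos_of_forall_le (h := Pi.single a (-1)) one_pos
    fun s _ _ => hv.2 (v + s • Pi.single a (-1))
  rw [sum_score_mul_single] at h1 h2
  linarith

theorem isMLE_of_score_eq_zero {ω : Assignment n m × Answers n m} {r : Subject n m}
    {v : Subject n m → ℝ} (hr : v r = 0) (hv : ∀ a, score ω v a = 0) : IsMLE ω r v :=
  ⟨hr, fun v' => by simpa [hv] using logLikelihood_le_tangent ω v v'⟩

theorem logLikelihood_sub_const (ω : Assignment n m × Answers n m) (v : Subject n m → ℝ)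
    (c : ℝ) : logLikelihood ω (fun a => v a - c) = logLikelihood ω v := by
  simp [logLikelihood]

/-- The observed wins cancel in the difference of two scores, so what remains is the divergence of a
flow that depends on the graph only. -/
theorem score_sub_score (ω : Assignment n m × Answers n m) (u v : Subject n m → ℝ)
    (a : Subject n m) : ∑ b, link ω.1 a b *
      (Real.sigmoid (v a - v b) - Real.sigmoid (u a - u b)) = score ω u a - score ω v a := by
  rw [score, score, ← Finset.sum_sub_distrib]
  exact Finset.sum_congr rfl fun b _ => by ring

theorem continuous_logLikelihood (ω : Assignment n m × Answers n m) :
    Continuous (logLikelihood ω) := by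
  unfold logLikelihood
  refine continuous_finsetSum _ fun a _ => continuous_finsetSum _ fun b _ => ?_
  refine continuous_const.mul (Continuous.log ?_ fun v => (Real.sigmoid_pos _).ne')
  exact continuous_sigmoid.comp ((continuous_apply a).sub (continuous_apply b))

/-! ### The maximizer under an oscillation constraint -/

/-- A maximizer of the log-likelihood among the merit vectors whose error oscillates by at most
`ε`, with the first order conditions that it satisfies. -/
theorem exists_constrained_maximizer (ω : Assignment n m × Answers n m) (r : Subject n m)
    (u : Subject n m → ℝ) (hu : u r = 0) {ε : ℝ} (hε : 0 < ε) :
    ∃ v : Subject n m → ℝ, v r = 0 ∧ (∀ a b, (v a - u a) - (v b - u b) ≤ ε) ∧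
      (∀ a, (∃ b, v b - u b < v a - u a) → 0 ≤ score ω v a) ∧
      (∀ a, (∃ b, v a - u a < v b - u b) → score ω v a ≤ 0) ∧
      ((∀ a b, (v a - u a) - (v b - u b) < ε) → ∀ a, score ω v a = 0) := by
  set C : Set (Subject n m → ℝ) :=
    {v | v r = 0 ∧ ∀ a b, (v a - u a) - (v b - u b) ≤ ε} with hC
  have hclosed : IsClosed C := by
    rw [hC, Set.ofPred_and]
    refine (isClosed_eq (continuous_apply r) continuous_const).inter ?_
    simp only [Set.ofPred_forall]
    refine isClosed_iInter fun a => isClosed_iInter fun b => ?_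
    exact isClosed_le (by fun_prop) continuous_const
  have hbdd : C ⊆ Metric.closedBall u ε := by
    intro v hv
    rw [mem_closedBall_iff_norm, pi_norm_le_iff_of_nonneg hε.le]
    intro a
    have h1 := hv.2 a r
    have h2 := hv.2 r a
    rw [hv.1, hu] at h1 h2
    rw [Real.norm_eq_abs, Pi.sub_apply, abs_le]
    constructor <;> linarith
  have hcomp : IsCompact C := (isCompact_closedBall u ε).of_isClosed_subset hclosed hbdd
  obtain ⟨v, hvC, hmax⟩ := hcomp.exists_isMaxOn ⟨u, hu, fun a b => by simpa using hε.le⟩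
    (continuous_logLikelihood ω).continuousOn
  -- The constraint and the log-likelihood see only differences of merits, so the normalization at
  -- `r` may be dropped. This makes perturbations at `r` itself admissible.
  have hmax' : ∀ v' : Subject n m → ℝ, (∀ a b, (v' a - u a) - (v' b - u b) ≤ ε) →
      logLikelihood ω v' ≤ logLikelihood ω v := by
    intro v' h
    rw [← logLikelihood_sub_const ω v' (v' r)]
    refine hmax ⟨by simp, fun a b => ?_⟩
    linarith [h a b]
  have hdown : ∀ a s₀, 0 < s₀ → (∀ s, 0 ≤ s → s ≤ s₀ → ∀ b, (v b - u b) - (v a - s - u a) ≤ ε) →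
      0 ≤ score ω v a := by
    intro a s₀ hs₀ H
    have := sum_score_mul_nonpos_of_forall_le (ω := ω) (v := v) (h := Pi.single a (-1)) hs₀ ?_
    · rw [sum_score_mul_single] at this
      linarith
    intro s hs0 hs1
    apply hmax'
    intro b c
    have hb := hvC.2 b c
    have hc := H s hs0 hs1 b
    have hv1 := hvC.2 a c
    by_cases h1 : b = a <;> by_cases h2 : c = a
    · simp [h1, h2, hε.le]
    · subst h1; simp [h2]; linarith
    · subst h2; simp [h1]; linarith
    · simp [h1, h2]; linarith
  have hup : ∀ a s₀, 0 < s₀ → (∀ s, 0 ≤ s → s ≤ s₀ → ∀ b, (v a + s - u a) - (v b - u b) ≤ ε) →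
      score ω v a ≤ 0 := by
    intro a s₀ hs₀ H
    have := sum_score_mul_nonpos_of_forall_le (ω := ω) (v := v) (h := Pi.single a 1) hs₀ ?_
    · rw [sum_score_mul_single] at this
      linarith
    intro s hs0 hs1
    apply hmax'
    intro b c
    have hb := hvC.2 b c
    have hc := H s hs0 hs1 c
    have hv1 := hvC.2 b a
    by_cases h1 : b = a <;> by_cases h2 : c = a
    · simp [h1, h2, hε.le]
    · subst h1; simp [h2]; linarith
    · subst h2; simp [h1]; linarith
    · simp [h1, h2]; linarith
  refine ⟨v, hvC.1, hvC.2, ?_, ?_, ?_⟩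
  · rintro a ⟨b, hb⟩
    -- Lowered by at most its gap to `b`, the error at `a` stays above that at `b`, from which no
    -- other error is more than `ε` away.
    refine hdown a ((v a - u a) - (v b - u b)) (by linarith) fun s _ hs c => ?_
    linarith [hvC.2 c b]
  · rintro a ⟨b, hb⟩
    refine hup a ((v b - u b) - (v a - u a)) (by linarith) fun s _ hs c => ?_
    linarith [hvC.2 b c]
  · intro H a
    have : Nonempty (Subject n m × Subject n m) := ⟨(r, r)⟩
    obtain ⟨p, hp⟩ := Finite.exists_max
      fun p : Subject n m × Subject n m => (v p.1 - u p.1) - (v p.2 - u p.2)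
    have hs := H p.1 p.2
    apply le_antisymm
    · refine hup a (ε - ((v p.1 - u p.1) - (v p.2 - u p.2))) (by linarith) fun s _ hs c => ?_
      linarith [hp (a, c)]
    · refine hdown a (ε - ((v p.1 - u p.1) - (v p.2 - u p.2))) (by linarith) fun s _ hs c => ?_
      linarith [hp (c, a)]

/-! ### Degrees and edge counts -/

theorem sum_subject (U : Finset (Subject n m)) (f : Subject n m → ℝ) :
    ∑ a ∈ U, f a = ∑ i ∈ U.toLeft, f (Sum.inl i) + ∑ j ∈ U.toRight, f (Sum.inr j) := by
  conv_lhs => rw [← Finset.toLeft_disjSum_toRight (u := U)]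
  rw [Finset.sum_disjSum]

theorem sum_mem_eq_card_inter (J B : Finset (Fin m)) :
    ∑ j ∈ B, (if j ∈ J then (1 : ℝ) else 0) = ((J ∩ B).card : ℝ) := by
  rw [Finset.sum_boole, Finset.inter_comm, Finset.filter_mem_eq_inter]

theorem degree_inl (G : Assignment n m) (i : Fin n) : degree G (Sum.inl i) = (G i).card := by
  simp [degree, link]

theorem degree_inr (G : Assignment n m) (j : Fin m) :
    degree G (Sum.inr j) = ∑ i, if j ∈ G i then (1 : ℝ) else 0 := by
  simp [degree, link]

theorem degree_nonneg (G : Assignment n m) (a : Subject n m) : 0 ≤ degree G a :=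
  Finset.sum_nonneg fun b _ => link_nonneg G a b

/-- The number of edges between a set of left vertices and a set of right vertices. -/
def edgeCount (G : Assignment n m) (A : Finset (Fin n)) (B : Finset (Fin m)) : ℝ :=
  ∑ i ∈ A, ((G i ∩ B).card : ℝ)

/-- The expected degree of a right vertex of the graph `B(n, m, d)`. -/
def meanDegree (n m d : ℕ) : ℝ := n * d / m

theorem sum_link_inl (G : Assignment n m) (i : Fin n) (V : Finset (Subject n m)) :
    ∑ b ∈ V, link G (Sum.inl i) b = ((G i ∩ V.toRight).card : ℝ) := by
  rw [sum_subject, ← sum_mem_eq_card_inter]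
  simp [link]

theorem sum_sum_link (G : Assignment n m) (U V : Finset (Subject n m)) :
    ∑ a ∈ U, ∑ b ∈ V, link G a b =
      edgeCount G U.toLeft V.toRight + edgeCount G V.toLeft U.toRight := by
  rw [sum_subject U, edgeCount, edgeCount]
  congr 1
  · exact Finset.sum_congr rfl fun i _ => sum_link_inl G i V
  · rw [Finset.sum_comm, sum_subject V]
    have : ∑ j ∈ V.toRight, ∑ x ∈ U.toRight, link G (Sum.inr x) (Sum.inr j) = 0 := by
      simp [link]
    rw [this, add_zero]
    refine Finset.sum_congr rfl fun i _ => ?_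
    rw [← sum_mem_eq_card_inter]
    rfl

theorem sum_degree (G : Assignment n m) (U : Finset (Subject n m)) :
    ∑ a ∈ U, degree G a =
      edgeCount G U.toLeft Finset.univ + ∑ j ∈ U.toRight, degree G (Sum.inr j) := by
  rw [sum_subject]
  simp [degree_inl, edgeCount]

theorem sum_degree_inr (G : Assignment n m) (B : Finset (Fin m)) :
    ∑ j ∈ B, degree G (Sum.inr j) = edgeCount G Finset.univ B := by
  simp_rw [degree_inr, edgeCount]
  rw [Finset.sum_comm]
  exact Finset.sum_congr rfl fun i _ => sum_mem_eq_card_inter _ _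

theorem edgeCount_add_compl_right (G : Assignment n m) (A : Finset (Fin n))
    (B : Finset (Fin m)) :
    edgeCount G A B + edgeCount G A Bᶜ = edgeCount G A Finset.univ := by
  simp_rw [edgeCount, ← Finset.sum_add_distrib, ← sum_mem_eq_card_inter]
  exact Finset.sum_congr rfl fun i _ => Finset.sum_add_sum_compl _ _

theorem edgeCount_add_compl_left (G : Assignment n m) (A : Finset (Fin n))
    (B : Finset (Fin m)) :
    edgeCount G A B + edgeCount G Aᶜ B = edgeCount G Finset.univ B :=
  Finset.sum_add_sum_compl _ _

theorem edgeCount_nonneg (G : Assignment n m) (A : Finset (Fin n)) (B : Finset (Fin m)) :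
    0 ≤ edgeCount G A B := Finset.sum_nonneg fun _ _ => Nat.cast_nonneg _

/-! ### Expansion of vertex sets -/

/-- Degree regularity and edge expansion, at the scale `L`, of a task assignment graph. -/
structure IsExpander (d : ℕ) (L : ℝ) (G : Assignment n m) : Prop where
  card_eq : ∀ i, (G i).card = d
  le_degree : ∀ j, 9 / 10 * meanDegree n m d ≤ degree G (Sum.inr j)
  degree_le : ∀ j, degree G (Sum.inr j) ≤ 2 * meanDegree n m d
  edgeCount_lt : ∀ A B, edgeCount G A B <
    max (4 / 3 * ((d : ℝ) * A.card * B.card / m)) (48 * ((A.card : ℝ) + B.card + 1) * L)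

namespace IsExpander

variable {d : ℕ} {L : ℝ} {G : Assignment n m}

theorem edgeCount_univ_right (hG : IsExpander d L G) (A : Finset (Fin n)) :
    edgeCount G A Finset.univ = d * A.card := by
  simp [edgeCount, hG.card_eq, mul_comm]

theorem le_edgeCount_univ_left (hG : IsExpander d L G) (B : Finset (Fin m)) :
    9 / 10 * meanDegree n m d * B.card ≤ edgeCount G Finset.univ B := by
  rw [← sum_degree_inr]
  have := Finset.card_nsmul_le_sum B (fun j => degree G (Sum.inr j)) _ fun j _ => hG.le_degree j
  rw [nsmul_eq_mul] at this
  linarith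

theorem edgeCount_univ_left_le (hG : IsExpander d L G) (B : Finset (Fin m)) :
    edgeCount G Finset.univ B ≤ 2 * meanDegree n m d * B.card := by
  rw [← sum_degree_inr]
  have := Finset.sum_le_card_nsmul B (fun j => degree G (Sum.inr j)) _ fun j _ => hG.degree_le j
  rw [nsmul_eq_mul] at this
  linarith

theorem right_growth (hG : IsExpander d L G) (hL : 0 < L) (hn : 0 < n) (hnm : n ≤ m)
    (hlam : 1000 * L ≤ meanDegree n m d) {A : Finset (Fin n)} {B : Finset (Fin m)}
    (hA : A.Nonempty) (h : 4 / 5 * (d * A.card) ≤ edgeCount G A B) :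
    3 / 5 ≤ (B.card : ℝ) / m ∨
      meanDegree n m d / (70 * L) * (A.card / n) ≤ (B.card : ℝ) / m := by
  have hn' : (0 : ℝ) < n := by exact_mod_cast hn
  have hnm' : (n : ℝ) ≤ m := by exact_mod_cast hnm
  have hm' : (0 : ℝ) < m := hn'.trans_le hnm'
  have hA' : (1 : ℝ) ≤ A.card := by exact_mod_cast hA.card_pos
  have hd : 1000 * L ≤ d := by
    refine hlam.trans ?_
    rw [meanDegree, div_le_iff₀ hm', mul_comm]
    gcongr
  have hd0 : (0 : ℝ) < d := by linarith
  rcases lt_max_iff.1 (hG.edgeCount_lt A B) with h1 | h1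
  -- If the count is governed by its mean, then 4/5 ≤ (4/3)|B|/m, which gives the density 3/5.
  · left
    have h2 := h.trans h1.le
    have e : 4 / 3 * (d * A.card * B.card / m : ℝ) = d * A.card * (4 / 3 * (B.card / m)) := by
      ring
    rw [e, mul_comm (4 / 5 : ℝ)] at h2
    have := le_of_mul_le_mul_left h2 (by positivity)
    linarith
  · right
    have e : meanDegree n m d / (70 * L) * (A.card / n) = d * A.card / (70 * L) / m := by
      rw [meanDegree]; field_simp
    rw [e]
    gcongr
    rw [div_le_iff₀ (by positivity)]
    -- As |A| ≥ 1 and d ≥ 1000L, the part 48(|A|+1)L is at most 0.096 d|A|. What remains is 0.704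
    -- d|A| ≤ 48|B|L, and 48/0.704 < 70.
    nlinarith [mul_le_mul_of_nonneg_right hd (show (0 : ℝ) ≤ A.card by positivity),
      mul_nonneg hL.le (show (0 : ℝ) ≤ B.card by positivity),
      mul_le_mul_of_nonneg_left hA' hL.le]

theorem left_growth (hG : IsExpander d L G) (hL : 0 < L) (hn : 0 < n) (hnm : n ≤ m)
    (hlam : 1000 * L ≤ meanDegree n m d) {A : Finset (Fin n)} {B : Finset (Fin m)}
    (hB : B.Nonempty) (h : 4 / 5 * (meanDegree n m d * B.card) ≤ edgeCount G A B) :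
    3 / 5 ≤ (A.card : ℝ) / n ∨
      meanDegree n m d / (70 * L) * (B.card / m) ≤ (A.card : ℝ) / n := by
  have hn' : (0 : ℝ) < n := by exact_mod_cast hn
  have hnm' : (n : ℝ) ≤ m := by exact_mod_cast hnm
  have hm' : (0 : ℝ) < m := hn'.trans_le hnm'
  have hB' : (1 : ℝ) ≤ B.card := by exact_mod_cast hB.card_pos
  have hlam0 : 0 < meanDegree n m d := by linarith
  rcases lt_max_iff.1 (hG.edgeCount_lt A B) with h1 | h1
  · left
    have h2 := h.trans h1.le
    have e : 4 / 3 * (d * A.card * B.card / m : ℝ) =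
        meanDegree n m d * B.card * (4 / 3 * (A.card / n)) := by
      rw [meanDegree]; field_simp
    rw [e, mul_comm (4 / 5 : ℝ)] at h2
    have := le_of_mul_le_mul_left h2 (by positivity)
    linarith
  · right
    have h3 : meanDegree n m d * B.card ≤ A.card * (70 * L) := by
      nlinarith [mul_le_mul_of_nonneg_right hlam (show (0 : ℝ) ≤ B.card by positivity),
        mul_nonneg hL.le (show (0 : ℝ) ≤ A.card by positivity),
        mul_le_mul_of_nonneg_left hB' hL.le]
    -- On this side the density of `A` refers to n and that of `B` to m; n ≤ m makes the comparison
    -- favourable.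
    calc meanDegree n m d / (70 * L) * (B.card / m)
        ≤ meanDegree n m d / (70 * L) * (B.card / n) := by gcongr
      _ = meanDegree n m d * B.card / (70 * L) / n := by ring
      _ ≤ (A.card : ℝ) / n := by
        gcongr
        rwa [div_le_iff₀ (by positivity)]

/-- If few of the edges at `U` leave `V`, then the larger side of `U` expands into `V`. -/
theorem growth (hG : IsExpander d L G) (hL : 0 < L) (hn : 0 < n) (hnm : n ≤ m)
    (hlam : 1000 * L ≤ meanDegree n m d) {U V : Finset (Subject n m)} (hU : U.Nonempty)
    (h : ∑ a ∈ U, ∑ b ∈ Vᶜ, link G a b ≤ 1 / 30 * ∑ a ∈ U, degree G a) :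
    ((U.toRight.card : ℝ) / m ≤ U.toLeft.card / n ∧ (3 / 5 ≤ (V.toRight.card : ℝ) / m ∨
      meanDegree n m d / (70 * L) * (U.toLeft.card / n) ≤ (V.toRight.card : ℝ) / m)) ∨
    ((U.toLeft.card : ℝ) / n ≤ U.toRight.card / m ∧ (3 / 5 ≤ (V.toLeft.card : ℝ) / n ∨
      meanDegree n m d / (70 * L) * (U.toRight.card / m) ≤ (V.toLeft.card : ℝ) / n)) := by
  have hn' : (0 : ℝ) < n := by exact_mod_cast hn
  have hnm' : (n : ℝ) ≤ m := by exact_mod_cast hnm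
  have hm' : (0 : ℝ) < m := hn'.trans_le hnm'
  have hlam0 : 0 < meanDegree n m d := by linarith
  have hd0 : (0 : ℝ) < d := by
    rw [meanDegree] at hlam0
    by_contra hd
    have : (d : ℝ) = 0 := le_antisymm (not_lt.1 hd) (by positivity)
    simp [this] at hlam0
  rw [sum_degree, sum_sum_link, sum_degree_inr, hG.edgeCount_univ_right] at h
  have eR : Vᶜ.toRight = V.toRightᶜ := by ext; simp
  have eL : Vᶜ.toLeft = V.toLeftᶜ := by ext; simp
  rw [eR, eL] at h
  have h1 := edgeCount_add_compl_right G U.toLeft V.toRight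
  rw [hG.edgeCount_univ_right] at h1
  have h2 := edgeCount_add_compl_left G V.toLeft U.toRight
  have h3 := hG.le_edgeCount_univ_left U.toRight
  have h4 := hG.edgeCount_univ_left_le U.toRight
  have h5 := edgeCount_nonneg G U.toLeft V.toRightᶜ
  have h6 := edgeCount_nonneg G V.toLeftᶜ U.toRight
  have cmp : ∀ a b : ℝ, (b / m ≤ a / n ↔ meanDegree n m d * b ≤ d * a) := by
    intro a b
    have e1 : meanDegree n m d * b = n * d * (b / m) := by rw [meanDegree]; ring
    have e2 : d * a = n * d * (a / n) := by field_simp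
    rw [e1, e2, mul_le_mul_iff_right₀ (by positivity)]
  rcases le_total ((U.toRight.card : ℝ) / m) (U.toLeft.card / n) with hc | hc
  · left
    refine ⟨hc, hG.right_growth hL hn hnm hlam ?_ ?_⟩
    · by_contra hne
      rw [Finset.not_nonempty_iff_eq_empty] at hne
      rw [hne] at hc
      simp only [Finset.card_empty, Nat.cast_zero, zero_div] at hc
      have h0 : (U.toRight.card : ℝ) ≤ 0 := by
        rw [div_le_iff₀ hm'] at hc; linarith
      have h00 : U.toRight = ∅ := by
        rw [← Finset.card_eq_zero]; exact_mod_cast le_antisymm h0 (Nat.cast_nonneg _)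
      rw [← Finset.toLeft_disjSum_toRight (u := U), hne, h00] at hU
      simp at hU
    · rw [cmp] at hc
      -- The degrees in `U` sum to at most 3d|U_L|, so at most d|U_L|/10 edges at U_L miss `V`.
      nlinarith
  · right
    refine ⟨hc, hG.left_growth hL hn hnm hlam ?_ ?_⟩
    · by_contra hne
      rw [Finset.not_nonempty_iff_eq_empty] at hne
      rw [hne] at hc
      simp only [Finset.card_empty, Nat.cast_zero, zero_div] at hc
      have h0 : (U.toLeft.card : ℝ) ≤ 0 := by
        rw [div_le_iff₀ hn'] at hc; linarith
      have h00 : U.toLeft = ∅ := by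
        rw [← Finset.card_eq_zero]; exact_mod_cast le_antisymm h0 (Nat.cast_nonneg _)
      rw [← Finset.toLeft_disjSum_toRight (u := U), hne, h00] at hU
      simp at hU
    · have hc' : d * (U.toLeft.card : ℝ) ≤ meanDegree n m d * U.toRight.card := by
        by_contra hlt
        have := (cmp U.toLeft.card U.toRight.card).2 (not_le.1 hlt).le
        have heq := le_antisymm this hc
        exact hlt (by
          have e1 : meanDegree n m d * U.toRight.card = n * d * (U.toRight.card / m) := by
            rw [meanDegree]; ring
          have e2 : d * (U.toLeft.card : ℝ) = n * d * (U.toLeft.card / n) := by field_simp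
          rw [e1, e2, heq])
      -- The degrees in `U` sum to at most 3λ|U_R|. Of at least (9/10)λ|U_R| edges at U_R at most
      -- (1/10)λ|U_R| miss `V`, which leaves exactly the required 4/5; this fixes the constant 1/30.
      nlinarith

/-- An increasing sequence of sets of subjects, each of which contains most of the edges at its
predecessor, soon contains most of the left vertices. -/
theorem card_toLeft_ge (hG : IsExpander d L G) (hL : 0 < L) (hn : 0 < n) (hnm : n ≤ m)
    (hlam : 1000 * L ≤ meanDegree n m d) {U : ℕ → Finset (Subject n m)} (hU0 : (U 0).Nonempty)
    (hmono : Monotone U) {K : ℕ}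
    (hK : (m : ℝ) ≤ (meanDegree n m d / (70 * L)) ^ K)
    (h : ∀ k ≤ K, ∑ a ∈ U k, ∑ b ∈ (U (k + 1))ᶜ, link G a b ≤ 1 / 30 * ∑ a ∈ U k, degree G a) :
    3 / 5 * (n : ℝ) ≤ (U (K + 1)).toLeft.card := by
  have hn' : (0 : ℝ) < n := by exact_mod_cast hn
  have hnm' : (n : ℝ) ≤ m := by exact_mod_cast hnm
  have hm' : (0 : ℝ) < m := hn'.trans_le hnm'
  set g := meanDegree n m d / (70 * L) with hg
  have hg1 : 1 ≤ g := by rw [hg, le_div_iff₀ (by positivity)]; linarith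
  have hUne : ∀ k, (U k).Nonempty := fun k => hU0.mono (hmono (Nat.zero_le k))
  -- The denser side alternates unpredictably, so the induction follows the larger density. It
  -- starts from a single vertex, of density at least 1/m.
  have main : ∀ k ≤ K, min (3 / 5) (g ^ k / m) ≤
      max (((U k).toLeft.card : ℝ) / n) ((U k).toRight.card / m) := by
    intro k
    induction k with
    | zero =>
      intro _
      refine (min_le_right _ _).trans ?_
      rw [pow_zero]
      obtain ⟨a, ha⟩ := hU0
      rcases a with i | j
      · refine le_max_of_le_left ?_
        have : (1 : ℝ) ≤ (U 0).toLeft.card := by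
          exact_mod_cast Finset.card_pos.2 ⟨i, Finset.mem_toLeft.2 ha⟩
        gcongr
      · refine le_max_of_le_right ?_
        have : (1 : ℝ) ≤ (U 0).toRight.card := by
          exact_mod_cast Finset.card_pos.2 ⟨j, Finset.mem_toRight.2 ha⟩
        gcongr
    | succ k ih =>
      intro hk
      have ih' := ih (by omega)
      have hmul : min (3 / 5) (g ^ (k + 1) / m) ≤ g * min (3 / 5) (g ^ k / m) := by
        rw [mul_min_of_nonneg _ _ (by linarith)]
        refine min_le_min (by linarith) ?_
        rw [pow_succ]
        apply le_of_eq; ring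
      rcases hG.growth hL hn hnm hlam (hUne k) (h k (by omega)) with ⟨hc, h1⟩ | ⟨hc, h1⟩
      · rw [max_eq_left hc] at ih'
        refine le_max_of_le_right ?_
        rcases h1 with h1 | h1
        · exact (min_le_left _ _).trans h1
        · exact hmul.trans ((mul_le_mul_of_nonneg_left ih' (by linarith)).trans h1)
      · rw [max_eq_right hc] at ih'
        refine le_max_of_le_left ?_
        rcases h1 with h1 | h1
        · exact (min_le_left _ _).trans h1
        · exact hmul.trans ((mul_le_mul_of_nonneg_left ih' (by linarith)).trans h1)
  have hfin := main K le_rfl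
  rw [min_eq_left (by
    rw [le_div_iff₀ hm']
    linarith)] at hfin
  rw [← le_div_iff₀ hn']
  -- One further level moves the density 3/5 to the left side in case it was reached on the right.
  rcases hG.growth hL hn hnm hlam (hUne K) (h K le_rfl) with ⟨hc, h1⟩ | ⟨hc, h1⟩
  · rw [max_eq_left hc] at hfin
    refine hfin.trans ?_
    gcongr
    exact hmono (Nat.le_succ K)
  · rw [max_eq_right hc] at hfin
    rcases h1 with h1 | h1
    · exact h1
    · refine hfin.trans (le_trans ?_ h1)
      exact le_mul_of_one_le_left (by linarith) hg1

/-! ### Flows of small divergence -/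

/-- The upper level sets of a function whose flow `F` has a small divergence grow fast. -/
theorem card_filter_ge (hG : IsExpander d L G) (hL : 0 < L) (hn : 0 < n) (hnm : n ≤ m)
    (hlam : 1000 * L ≤ meanDegree n m d) {K : ℕ}
    (hK : (m : ℝ) ≤ (meanDegree n m d / (70 * L)) ^ K)
    {δ : Subject n m → ℝ} {F : Subject n m → Subject n m → ℝ} {c t : ℝ} (hc : 0 < c)
    (ht : 0 < t) (hF : ∀ a b, F a b = -F b a)
    (hFδ : ∀ a b, δ b ≤ δ a → c * (δ a - δ b) ≤ F a b) (a₀ : Subject n m)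
    (hdiv : ∀ a, δ a₀ - K * t ≤ δ a →
      ∑ b, link G a b * F a b ≤ c * t / 30 * degree G a) :
    3 / 5 * (n : ℝ) ≤
      (Finset.univ.filter fun i : Fin n => δ a₀ - (K + 1) * t ≤ δ (Sum.inl i)).card := by
  set U : ℕ → Finset (Subject n m) :=
    fun k => Finset.univ.filter fun a => δ a₀ - k * t ≤ δ a with hU
  have hmono : Monotone U := by
    intro k l hkl a ha
    simp only [hU, Finset.mem_filter, Finset.mem_univ, true_and] at ha ⊢
    have : (k : ℝ) ≤ l := by exact_mod_cast hkl
    nlinarith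
  have hfin := hG.card_toLeft_ge hL hn hnm hlam (U := U) ⟨a₀, by simp [hU]⟩ hmono hK ?_
  · have e : (U (K + 1)).toLeft =
        Finset.univ.filter fun i : Fin n => δ a₀ - (K + 1) * t ≤ δ (Sum.inl i) := by
      ext i
      simp [hU]
    rwa [e] at hfin
  intro k hk
  have hkK : (k : ℝ) ≤ K := by exact_mod_cast hk
  have hdiv' : ∑ a ∈ U k, ∑ b, link G a b * F a b ≤ c * t / 30 * ∑ a ∈ U k, degree G a := by
    rw [Finset.mul_sum]
    refine Finset.sum_le_sum fun a ha => hdiv a ?_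
    simp only [hU, Finset.mem_filter, Finset.mem_univ, true_and] at ha
    nlinarith
  -- By antisymmetry the flow inside the level set cancels, so the total divergence is the flow out
  -- of it.
  have hint : ∑ a ∈ U k, ∑ b ∈ U k, link G a b * F a b = 0 := by
    have h1 : ∑ a ∈ U k, ∑ b ∈ U k, link G a b * F a b =
        -∑ a ∈ U k, ∑ b ∈ U k, link G a b * F a b := by
      conv_lhs => rw [Finset.sum_comm]
      rw [← Finset.sum_neg_distrib]
      refine Finset.sum_congr rfl fun a _ => ?_
      rw [← Finset.sum_neg_distrib]
      refine Finset.sum_congr rfl fun b _ => ?_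
      rw [link_comm, hF]
      ring
    linarith
  have hsplit : ∑ a ∈ U k, ∑ b, link G a b * F a b =
      ∑ a ∈ U k, ∑ b ∈ (U k)ᶜ, link G a b * F a b := by
    rw [← zero_add (∑ a ∈ U k, ∑ b ∈ (U k)ᶜ, link G a b * F a b), ← hint,
      ← Finset.sum_add_distrib]
    exact Finset.sum_congr rfl fun a _ => (Finset.sum_add_sum_compl _ _).symm
  -- Edges that leave U_k but stay in U_{k+1} carry nonnegative flow and are dropped. The others
  -- have a drop of δ greater than `t`.
  have hlow : c * t * ∑ a ∈ U k, ∑ b ∈ (U (k + 1))ᶜ, link G a b ≤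
      ∑ a ∈ U k, ∑ b ∈ (U k)ᶜ, link G a b * F a b := by
    rw [Finset.mul_sum]
    refine Finset.sum_le_sum fun a ha => ?_
    rw [Finset.mul_sum]
    simp only [hU, Finset.mem_filter, Finset.mem_univ, true_and] at ha
    refine (Finset.sum_le_sum fun b hb => ?_).trans
      (Finset.sum_le_sum_of_subset_of_nonneg
        (Finset.compl_subset_compl.2 (hmono (Nat.le_succ k))) fun b hb _ => ?_)
    · simp only [hU, Finset.mem_compl, Finset.mem_filter, Finset.mem_univ, true_and, not_le,
        Nat.cast_add, Nat.cast_one] at hb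
      have h1 := hFδ a b (by linarith)
      have h2 : c * t ≤ c * (δ a - δ b) := mul_le_mul_of_nonneg_left (by linarith) hc.le
      rw [mul_comm]
      exact mul_le_mul_of_nonneg_left (h2.trans h1) (link_nonneg G a b)
    · simp only [hU, Finset.mem_compl, Finset.mem_filter, Finset.mem_univ, true_and,
        not_le] at hb
      have h1 := hFδ a b (by linarith)
      exact mul_nonneg (link_nonneg G a b)
        (le_trans (mul_nonneg hc.le (by linarith)) h1)
  have hct : 0 < c * t := mul_pos hc ht
  have hall := (hlow.trans_eq hsplit.symm).trans hdiv'
  have e : c * t / 30 * ∑ a ∈ U k, degree G a =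
      c * t * (1 / 30 * ∑ a ∈ U k, degree G a) := by ring
  rw [e] at hall
  exact le_of_mul_le_mul_left hall hct

/-- A function whose flow `F` has a small divergence oscillates little. -/
theorem sub_le_of_flow (hG : IsExpander d L G) (hL : 0 < L) (hn : 0 < n) (hnm : n ≤ m)
    (hlam : 1000 * L ≤ meanDegree n m d) {K : ℕ}
    (hK : (m : ℝ) ≤ (meanDegree n m d / (70 * L)) ^ K)
    {δ : Subject n m → ℝ} {F : Subject n m → Subject n m → ℝ} {c t : ℝ} (hc : 0 < c)
    (ht : 0 < t) (hF : ∀ a b, F a b = -F b a)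
    (hFδ : ∀ a b, δ b ≤ δ a → c * (δ a - δ b) ≤ F a b)
    (hup : ∀ a, (∃ b, δ b < δ a) → ∑ b, link G a b * F a b ≤ c * t / 30 * degree G a)
    (hdown : ∀ a, (∃ b, δ a < δ b) → -(c * t / 30 * degree G a) ≤ ∑ b, link G a b * F a b)
    (a₁ a₂ : Subject n m) : δ a₁ - δ a₂ ≤ 2 * (K + 1) * t := by
  by_contra! hlt
  have hKt : (0 : ℝ) ≤ K * t := by positivity
  -- The assumed oscillation keeps `a₂` strictly below all levels used here, which is what makes the
  -- one-sided hypothesis `hup` available at them. For the lower levels δ and `F` change sign and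
  -- `a₁` plays this role.
  have h1 := hG.card_filter_ge hL hn hnm hlam hK hc ht hF hFδ a₁
    fun a ha => hup a ⟨a₂, by nlinarith⟩
  have h2 := hG.card_filter_ge hL hn hnm hlam hK (δ := fun a => -δ a)
    (F := fun a b => -F a b) hc ht (fun a b => by rw [hF a b])
    (fun a b hab => by
      have := hFδ b a (by linarith)
      rw [hF a b]
      linarith) a₂
    fun a ha => by
      have := hdown a ⟨a₁, by nlinarith⟩
      simp only [mul_neg, Finset.sum_neg_distrib]
      linarith
  have hdisj : Disjoint
      (Finset.univ.filter fun i : Fin n => δ a₁ - (K + 1) * t ≤ δ (Sum.inl i))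
      (Finset.univ.filter fun i : Fin n => -δ a₂ - (K + 1) * t ≤ -δ (Sum.inl i)) := by
    rw [Finset.disjoint_filter]
    intro i _ hi1 hi2
    linarith
  have hcard := Finset.card_le_univ (Finset.disjUnion _ _ hdisj)
  rw [Finset.card_disjUnion, Fintype.card_fin] at hcard
  have hcard' : ((Finset.univ.filter fun i : Fin n => δ a₁ - (K + 1) * t ≤ δ (Sum.inl i)).card : ℝ)
    + ((Finset.univ.filter fun i : Fin n => -δ a₂ - (K + 1) * t ≤ -δ (Sum.inl i)).card : ℝ) ≤ n :=
    by exact_mod_cast hcard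
  have hn' : (0 : ℝ) < n := by exact_mod_cast hn
  linarith

end IsExpander

/-! ### Moments of a uniformly random subset -/

/-- The ratio of the two binomial coefficients is the product of (d-i)/(m-i) over i < k, and each
factor is at most d/m. This is the comparison of sampling without replacement to independent
sampling. -/
theorem choose_sub_sub_le {m d : ℕ} (hm : 0 < m) (hdm : d ≤ m) {k : ℕ} (hk : k ≤ d) :
    ((m - k).choose (d - k) : ℝ) ≤ (d / m : ℝ) ^ k * m.choose d := by
  have hm' : (0 : ℝ) < m := by exact_mod_cast hm
  induction k with
  | zero => simp
  | succ k ih =>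
    have ih' := ih (by omega)
    obtain ⟨a, ha⟩ : ∃ a, m - k = a + 1 := ⟨m - k - 1, by omega⟩
    obtain ⟨b, hb⟩ : ∃ b, d - k = b + 1 := ⟨d - k - 1, by omega⟩
    have e1 : m - (k + 1) = a := by omega
    have e2 : d - (k + 1) = b := by omega
    rw [e1, e2]
    rw [ha, hb] at ih'
    have h1 : ((a : ℝ) + 1) * a.choose b = (a + 1).choose (b + 1) * (b + 1) := by
      exact_mod_cast Nat.add_one_mul_choose_eq a b
    have h2 : ((b : ℝ) + 1) * m ≤ d * (a + 1) := by
      have hmk : (m : ℝ) = a + 1 + k := by exact_mod_cast (by omega : m = a + 1 + k)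
      have hdk : (d : ℝ) = b + 1 + k := by exact_mod_cast (by omega : d = b + 1 + k)
      have hdm' : (d : ℝ) ≤ m := by exact_mod_cast hdm
      have hk0 : (0 : ℝ) ≤ k := Nat.cast_nonneg k
      nlinarith
    have h3 : (a.choose b : ℝ) ≤ d / m * (a + 1).choose (b + 1) := by
      have e : (a.choose b : ℝ) = (b + 1) / (a + 1) * (a + 1).choose (b + 1) := by
        field_simp; linarith
      rw [e]
      gcongr ?_ * _
      rw [div_le_div_iff₀ (by positivity) hm']
      exact h2
    calc (a.choose b : ℝ) ≤ d / m * (a + 1).choose (b + 1) := h3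
      _ ≤ d / m * ((d / m : ℝ) ^ k * m.choose d) := by gcongr
      _ = _ := by ring

/-- The uniform distribution on the `d`-element subsets of `Fin m`. -/
abbrev subsetLaw (m d : ℕ) : Measure (Finset (Fin m)) :=
  uniformOn {J : Finset (Fin m) | J.card = d}

theorem isProbabilityMeasure_subsetLaw {m d : ℕ} (hdm : d ≤ m) :
    IsProbabilityMeasure (subsetLaw m d) := by
  refine isProbabilityMeasure_uniformOn (Set.toFinite _) ?_
  obtain ⟨J, -, hJ⟩ := Finset.exists_subset_card_eq
    (s := (Finset.univ : Finset (Fin m))) (n := d) (by simpa using hdm)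
  exact ⟨J, hJ⟩

theorem subsetLaw_real_superset {m d : ℕ} (S : Finset (Fin m)) (hS : S.card ≤ d) :
    (subsetLaw m d).real {J | S ⊆ J} = ((m - S.card).choose (d - S.card) : ℝ) / m.choose d := by
  have e1 : {J : Finset (Fin m) | J.card = d} =
      (Finset.powersetCard d (Finset.univ : Finset (Fin m)) : Set (Finset (Fin m))) := by
    ext J; simp
  have e2 : {J : Finset (Fin m) | S ⊆ J} =
      ((Finset.univ.filter fun J => S ⊆ J : Finset (Finset (Fin m))) : Set (Finset (Fin m))) := by
    ext J; simp
  have e3 : Finset.powersetCard d (Finset.univ : Finset (Fin m)) ∩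
      Finset.univ.filter (fun J => S ⊆ J) = (Finset.powersetCard d Finset.univ).filter (S ⊆ ·) := by
    ext J; simp
  rw [measureReal_def, subsetLaw, e1, e2, uniformOn_apply_finset, e3,
    Finset.card_filter_powersetCard_subset _ _ _ (Finset.subset_univ _) hS,
    Finset.card_powersetCard]
  simp

theorem subsetLaw_real_superset_le {m d : ℕ} (hm : 0 < m) (hdm : d ≤ m) (S : Finset (Fin m)) :
    (subsetLaw m d).real {J | S ⊆ J} ≤ (d / m : ℝ) ^ S.card := by
  rcases le_or_gt S.card d with hS | hS
  · rw [subsetLaw_real_superset S hS, div_le_iff₀ (by exact_mod_cast Nat.choose_pos hdm)]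
    exact choose_sub_sub_le hm hdm hS
  · have : (subsetLaw m d) {J | S ⊆ J} = 0 := by
      rw [subsetLaw, uniformOn_eq_zero_iff (Set.toFinite _)]
      ext J
      simp only [Set.mem_inter_iff, Set.mem_ofPred_eq, Set.mem_empty_iff_false, iff_false, not_and]
      intro hJ hSJ
      have := Finset.card_le_card hSJ
      omega
    rw [measureReal_def, this, ENNReal.toReal_zero]
    positivity

theorem subsetLaw_real_mem {m d : ℕ} (hm : 0 < m) (hd : 1 ≤ d) (hdm : d ≤ m) (j : Fin m) :
    (subsetLaw m d).real {J | {j} ⊆ J} = d / m := by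
  rw [subsetLaw_real_superset _ (by simpa using hd), Finset.card_singleton]
  obtain ⟨a, rfl⟩ : ∃ a, m = a + 1 := ⟨m - 1, by omega⟩
  obtain ⟨b, rfl⟩ : ∃ b, d = b + 1 := ⟨d - 1, by omega⟩
  have h1 : ((a : ℝ) + 1) * a.choose b = (a + 1).choose (b + 1) * (b + 1) := by
    exact_mod_cast Nat.add_one_mul_choose_eq a b
  have h2 : (0 : ℝ) < (a + 1).choose (b + 1) := by exact_mod_cast Nat.choose_pos hdm
  simp only [Nat.add_sub_cancel]
  push_cast
  rw [div_eq_div_iff h2.ne' (by positivity)]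
  linarith

/-- Expanding the product over `B` of 1 + x·1[j ∈ J] reduces exponential moments of |J ∩ B| to the
probabilities that `J` contains a given set. -/
theorem one_add_pow_card_inter (x : ℝ) (J B : Finset (Fin m)) :
    (1 + x) ^ (J ∩ B).card =
      ∑ S ∈ B.powerset, x ^ S.card * Set.indicator {J : Finset (Fin m) | S ⊆ J} 1 J := by
  have h1 : (1 + x) ^ (J ∩ B).card = ∏ j ∈ B, (1 + if j ∈ J then x else 0) := by
    rw [Finset.inter_comm, ← Finset.filter_mem_eq_inter, ← Finset.prod_const, Finset.prod_filter]
    exact Finset.prod_congr rfl fun j _ => by split_ifs <;> simp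
  rw [h1, Finset.prod_one_add]
  refine Finset.sum_congr rfl fun S _ => ?_
  rw [Finset.prod_ite_zero, Finset.prod_const]
  by_cases h : S ⊆ J
  · rw [if_pos fun j hj => h hj, Set.indicator_of_mem (by exact h)]; simp
  · rw [if_neg fun hh => h fun j hj => hh j hj, Set.indicator_of_notMem (by exact h)]; simp

theorem integral_one_add_pow_card_inter {m d : ℕ} (hdm : d ≤ m) (x : ℝ) (B : Finset (Fin m)) :
    ∫ J, (1 + x) ^ (J ∩ B).card ∂(subsetLaw m d) =
      ∑ S ∈ B.powerset, x ^ S.card * (subsetLaw m d).real {J | S ⊆ J} := by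
  have := isProbabilityMeasure_subsetLaw hdm
  simp_rw [one_add_pow_card_inter]
  rw [integral_finsetSum _ fun S _ => Integrable.of_finite]
  refine Finset.sum_congr rfl fun S _ => ?_
  rw [integral_const_mul, integral_indicator_one (Set.toFinite _).measurableSet]

theorem integral_one_add_pow_card_inter_le {m d : ℕ} (hm : 0 < m) (hdm : d ≤ m) {x : ℝ}
    (hx : 0 ≤ x) (B : Finset (Fin m)) :
    ∫ J, (1 + x) ^ (J ∩ B).card ∂(subsetLaw m d) ≤ Real.exp (x * (d * B.card / m)) := by
  rw [integral_one_add_pow_card_inter hdm]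
  calc ∑ S ∈ B.powerset, x ^ S.card * (subsetLaw m d).real {J | S ⊆ J}
      ≤ ∑ S ∈ B.powerset, ∏ j ∈ S, (x * (d / m : ℝ)) := by
        refine Finset.sum_le_sum fun S _ => ?_
        rw [Finset.prod_const, mul_pow]
        gcongr
        exact subsetLaw_real_superset_le hm hdm S
    _ = ∏ j ∈ B, (1 + x * (d / m : ℝ)) := (Finset.prod_one_add B).symm
    _ ≤ Real.exp (∑ j ∈ B, x * (d / m : ℝ)) := by
        rw [Real.exp_sum]
        refine Finset.prod_le_prod (fun j _ => by positivity) fun j _ => ?_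
        rw [add_comm]
        exact Real.add_one_le_exp _
    _ = _ := by
        rw [Finset.sum_const, nsmul_eq_mul]
        congr 1
        ring

/-- The lower tail needs x < 0, for which termwise upper bounds on containment probabilities have
the wrong sign. For a singleton the expansion has two terms, both known exactly. -/
theorem integral_one_add_pow_card_inter_singleton_le {m d : ℕ} (hm : 0 < m) (hd : 1 ≤ d)
    (hdm : d ≤ m) (x : ℝ) (j : Fin m) :
    ∫ J, (1 + x) ^ (J ∩ {j}).card ∂(subsetLaw m d) ≤ Real.exp (x * (d / m)) := by
  have := isProbabilityMeasure_subsetLaw hdm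
  have hp : ({j} : Finset (Fin m)).powerset = {∅, {j}} := by
    ext S; simp [Finset.subset_singleton_iff]
  rw [integral_one_add_pow_card_inter hdm, hp,
    Finset.sum_pair (Finset.singleton_ne_empty j).symm, subsetLaw_real_mem hm hd hdm]
  have : {J : Finset (Fin m) | ∅ ⊆ J} = Set.univ := by ext; simp
  rw [this, probReal_univ]
  simp only [Finset.card_empty, pow_zero, mul_one, Finset.card_singleton, pow_one]
  rw [add_comm]
  exact Real.add_one_le_exp _

/-! ### The random graph is an expander with high probability -/

theorem isProbabilityMeasure_assignmentLaw {n m d : ℕ} (hdm : d ≤ m) :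
    IsProbabilityMeasure (assignmentLaw n m d) := by
  have := isProbabilityMeasure_subsetLaw hdm
  unfold assignmentLaw
  infer_instance

theorem mgf_edgeCount_le {n m d : ℕ} (hdm : d ≤ m) (A : Finset (Fin n)) (B : Finset (Fin m))
    {θ b : ℝ}
    (h : ∫ J, (1 + (Real.exp θ - 1)) ^ (J ∩ B).card ∂(subsetLaw m d) ≤ Real.exp b) :
    mgf (fun G => edgeCount G A B) (assignmentLaw n m d) θ ≤ Real.exp (A.card * b) := by
  have := isProbabilityMeasure_subsetLaw hdm
  have e : ∀ G : Assignment n m, Real.exp (θ * edgeCount G A B) =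
      ∏ i, (if i ∈ A then (1 + (Real.exp θ - 1)) ^ (G i ∩ B).card else 1) := by
    intro G
    rw [edgeCount, Finset.mul_sum, Real.exp_sum, Finset.prod_ite_mem, Finset.univ_inter]
    refine Finset.prod_congr rfl fun i _ => ?_
    rw [mul_comm, Real.exp_nat_mul]
    simp
  rw [mgf]
  simp_rw [e]
  rw [assignmentLaw, integral_fintype_prod_eq_prod (fun i (J : Finset (Fin m)) =>
    if i ∈ A then (1 + (Real.exp θ - 1)) ^ (J ∩ B).card else 1)]
  have e2 : Real.exp (A.card * b) = ∏ i : Fin n, if i ∈ A then Real.exp b else 1 := by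
    rw [Finset.prod_ite_mem, Finset.univ_inter, Finset.prod_const, Real.exp_nat_mul]
  rw [e2]
  refine Finset.prod_le_prod (fun i _ => integral_nonneg fun J => ?_) fun i _ => ?_
  · dsimp only
    split_ifs
    · have := Real.exp_pos θ
      exact pow_nonneg (by simpa using this.le) _
    · simp
  · split_ifs
    · exact h
    · simp

theorem integrable_assignmentLaw {d : ℕ} (hdm : d ≤ m) (f : Assignment n m → ℝ) :
    Integrable f (assignmentLaw n m d) := by
  have := isProbabilityMeasure_assignmentLaw (n := n) hdm
  exact Integrable.of_finite

theorem assignmentLaw_le_edgeCount {n m d : ℕ} (hm : 0 < m) (hdm : d ≤ m) (A : Finset (Fin n))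
    (B : Finset (Fin m)) {T : ℝ} (hT : 4 / 3 * (d * A.card * B.card / m) ≤ T) :
    (assignmentLaw n m d).real {G | T ≤ edgeCount G A B} ≤ Real.exp (-(T / 48)) := by
  have := isProbabilityMeasure_assignmentLaw (n := n) hdm
  -- Chernoff at parameter 1/6: since the mean is at most 3T/4, the exponent is at most -T/6 +
  -- (7/36)(3T/4) = -T/48.
  have h0 : 0 ≤ Real.exp (1 / 6) - 1 := by linarith [Real.add_one_le_exp (1 / 6 : ℝ)]
  have h1 : Real.exp (1 / 6) - 1 ≤ 7 / 36 := by
    have := Real.abs_exp_sub_one_sub_id_le (x := 1 / 6) (by norm_num [abs_le])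
    have := (abs_le.1 this).2
    linarith
  refine (measure_ge_le_exp_mul_mgf T (t := 1 / 6) (by norm_num)
    (integrable_assignmentLaw hdm _)).trans ?_
  refine (mul_le_mul_of_nonneg_left (mgf_edgeCount_le hdm A B
    (integral_one_add_pow_card_inter_le hm hdm h0 B)) (Real.exp_pos _).le).trans ?_
  rw [← Real.exp_add, Real.exp_le_exp]
  have hμ : (0 : ℝ) ≤ d * A.card * B.card / m := by positivity
  have e : (A.card : ℝ) * ((Real.exp (1 / 6) - 1) * (d * B.card / m)) =
      (Real.exp (1 / 6) - 1) * (d * A.card * B.card / m) := by ring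
  rw [e]
  nlinarith [mul_le_mul_of_nonneg_right h1 hμ]

theorem assignmentLaw_edgeCount_singleton_le {n m d : ℕ} (hm : 0 < m) (hd : 1 ≤ d) (hdm : d ≤ m)
    (j : Fin m) :
    (assignmentLaw n m d).real {G | edgeCount G Finset.univ {j} ≤ 9 / 10 * meanDegree n m d} ≤
      Real.exp (-(meanDegree n m d / 200)) := by
  have := isProbabilityMeasure_assignmentLaw (n := n) hdm
  -- Chernoff at parameter -1/10: the exponent is at most (9/100 - 19/200)λ = -λ/200.
  have h1 : Real.exp (-(1 / 10)) - 1 ≤ -(19 / 200) := by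
    have h2 := Real.quadratic_le_exp_of_nonneg (x := 1 / 10) (by norm_num)
    have h3 : Real.exp (-(1 / 10)) * Real.exp (1 / 10) = 1 := by rw [← Real.exp_add]; simp
    nlinarith [Real.exp_pos (-(1 / 10))]
  refine (measure_le_le_exp_mul_mgf _ (t := -(1 / 10)) (by norm_num)
    (integrable_assignmentLaw hdm _)).trans ?_
  refine (mul_le_mul_of_nonneg_left (mgf_edgeCount_le hdm Finset.univ {j}
    (integral_one_add_pow_card_inter_singleton_le hm hd hdm _ j)) (Real.exp_pos _).le).trans ?_
  rw [← Real.exp_add, Real.exp_le_exp, Finset.card_univ, Fintype.card_fin]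
  have hμ : (0 : ℝ) ≤ meanDegree n m d := by rw [meanDegree]; positivity
  have e : (n : ℝ) * ((Real.exp (-(1 / 10)) - 1) * (d / m)) =
      (Real.exp (-(1 / 10)) - 1) * meanDegree n m d := by rw [meanDegree]; ring
  rw [e]
  nlinarith [mul_le_mul_of_nonneg_right h1 hμ]

theorem degree_inr_eq_edgeCount (G : Assignment n m) (j : Fin m) :
    degree G (Sum.inr j) = edgeCount G Finset.univ {j} := by
  rw [← sum_degree_inr, Finset.sum_singleton]

theorem ae_card_eq {n m d : ℕ} (hdm : d ≤ m) :
    ∀ᵐ G ∂(assignmentLaw n m d), ∀ i, (G i).card = d := by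
  have := isProbabilityMeasure_subsetLaw hdm
  rw [ae_all_iff]
  intro i
  have h : ∀ᵐ J ∂(subsetLaw m d), J.card = d := by
    rw [ae_iff]
    refine (uniformOn_eq_zero_iff (Set.toFinite _)).2 ?_
    ext J
    simp
  exact (Measure.quasiMeasurePreserving_eval (fun _ : Fin n => subsetLaw m d) i).ae h

/-- The sum factors as e^{-L}(1 + e^{-L})^{n+m}. The weight e^{-L} per vertex thus pays for the
choice of both sets, and the extra 1 in the exponent leaves a small probability. -/
theorem sum_exp_neg_card_le (n m : ℕ) {L : ℝ} (hL : ((n : ℝ) + m) * Real.exp (-L) ≤ 1) :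
    ∑ A : Finset (Fin n), ∑ B : Finset (Fin m), Real.exp (-((A.card + B.card + 1) * L)) ≤
      3 * Real.exp (-L) := by
  have hpow : ∀ k : ℕ, ∑ A : Finset (Fin k), Real.exp (-L) ^ A.card = (1 + Real.exp (-L)) ^ k := by
    intro k
    have := Finset.prod_one_add (f := fun _ : Fin k => Real.exp (-L)) Finset.univ
    simpa using this.symm
  have e : ∑ A : Finset (Fin n), ∑ B : Finset (Fin m), Real.exp (-((A.card + B.card + 1) * L)) =
      Real.exp (-L) * (1 + Real.exp (-L)) ^ (n + m) := by
    rw [pow_add, ← hpow, ← hpow, Finset.sum_mul_sum, Finset.mul_sum]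
    refine Finset.sum_congr rfl fun A _ => ?_
    rw [Finset.mul_sum]
    refine Finset.sum_congr rfl fun B _ => ?_
    rw [← Real.exp_nat_mul, ← Real.exp_nat_mul, ← Real.exp_add, ← Real.exp_add]
    congr 1
    ring
  rw [e, mul_comm]
  gcongr
  calc (1 + Real.exp (-L)) ^ (n + m) ≤ Real.exp (Real.exp (-L)) ^ (n + m) := by
        gcongr
        rw [add_comm]
        exact Real.add_one_le_exp _
    _ = Real.exp (((n : ℝ) + m) * Real.exp (-L)) := by rw [← Real.exp_nat_mul]; push_cast; rfl
    _ ≤ Real.exp 1 := Real.exp_le_exp.2 hL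
    _ ≤ 3 := Real.exp_one_lt_three.le

/-- The lower and upper degree bounds fail with probability at most e^{-L} each, and the edge counts
with probability at most 3e^{-L}. The threshold 48(|A|+|B|+1)L is what turns the tail e^{-T/48} into
a summable weight. -/
theorem assignmentLaw_not_isExpander_le {n m d : ℕ} (hm : 0 < m) (hd : 1 ≤ d) (hdm : d ≤ m)
    {L : ℝ} (hL0 : 0 < L) (hL : ((n : ℝ) + m) * Real.exp (-L) ≤ 1)
    (hlam : 1000 * L ≤ meanDegree n m d) :
    (assignmentLaw n m d).real {G | ¬ IsExpander d L G} ≤ 5 * Real.exp (-L) := by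
  have := isProbabilityMeasure_assignmentLaw (n := n) hdm
  set μ := assignmentLaw n m d
  set T : Finset (Fin n) → Finset (Fin m) → ℝ := fun A B =>
    max (4 / 3 * ((d : ℝ) * A.card * B.card / m)) (48 * ((A.card : ℝ) + B.card + 1) * L) with hT
  have hsub : {G : Assignment n m | ¬ IsExpander d L G} ⊆
      {G | ¬ ∀ i, (G i).card = d} ∪
      ((⋃ j : Fin m, {G | edgeCount G Finset.univ {j} ≤ 9 / 10 * meanDegree n m d}) ∪
      ((⋃ j : Fin m, {G | 2 * meanDegree n m d ≤ edgeCount G Finset.univ {j}}) ∪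
      ⋃ A : Finset (Fin n), ⋃ B : Finset (Fin m), {G | T A B ≤ edgeCount G A B})) := by
    intro G hG
    by_contra hcon
    simp only [Set.mem_union, Set.mem_iUnion, Set.mem_ofPred_eq, not_or, not_exists, not_le,
      not_not] at hcon
    exact hG ⟨hcon.1, fun j => by rw [degree_inr_eq_edgeCount]; exact (hcon.2.1 j).le,
      fun j => by rw [degree_inr_eq_edgeCount]; exact (hcon.2.2.1 j).le,
      fun A B => hcon.2.2.2 A B⟩
  have b0 : μ.real {G | ¬ ∀ i, (G i).card = d} = 0 := by
    rw [measureReal_def, ae_iff.1 (ae_card_eq hdm), ENNReal.toReal_zero]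
  -- One factor e^{-L} absorbs the union over the m right vertices.
  have hexp : ∀ c : ℝ, 2 ≤ c → m * Real.exp (-(c * L)) ≤ Real.exp (-L) := by
    intro c hc
    have h1 : Real.exp (-(c * L)) ≤ Real.exp (-L) * Real.exp (-L) := by
      rw [← Real.exp_add, Real.exp_le_exp]; nlinarith
    have h2 : (m : ℝ) * Real.exp (-L) ≤ 1 := by
      refine le_trans ?_ hL
      gcongr
      linarith [Nat.cast_nonneg (α := ℝ) n]
    calc m * Real.exp (-(c * L)) ≤ m * (Real.exp (-L) * Real.exp (-L)) := by gcongr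
      _ = m * Real.exp (-L) * Real.exp (-L) := by ring
      _ ≤ 1 * Real.exp (-L) := by gcongr
      _ = _ := one_mul _
  have b1 : μ.real (⋃ j : Fin m,
      {G | edgeCount G Finset.univ {j} ≤ 9 / 10 * meanDegree n m d}) ≤ Real.exp (-L) := by
    refine (measureReal_iUnion_fintype_le _).trans ?_
    refine (Finset.sum_le_card_nsmul _ _ (Real.exp (-(5 * L))) fun j _ =>
      (assignmentLaw_edgeCount_singleton_le hm hd hdm j).trans
        (Real.exp_le_exp.2 (by linarith))).trans ?_
    simpa using hexp 5 (by norm_num)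
  have b2 : μ.real (⋃ j : Fin m,
      {G | 2 * meanDegree n m d ≤ edgeCount G Finset.univ {j}}) ≤ Real.exp (-L) := by
    refine (measureReal_iUnion_fintype_le _).trans ?_
    refine (Finset.sum_le_card_nsmul _ _ (Real.exp (-(5 * L))) fun j _ =>
      (assignmentLaw_le_edgeCount hm hdm Finset.univ {j} ?_).trans
        (Real.exp_le_exp.2 (by linarith))).trans ?_
    · have e : (d * (Finset.univ : Finset (Fin n)).card * ({j} : Finset (Fin m)).card / m : ℝ) =
          meanDegree n m d := by
        rw [meanDegree, Finset.card_univ, Fintype.card_fin, Finset.card_singleton]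
        push_cast; ring
      rw [e]
      linarith
    · simpa using hexp 5 (by norm_num)
  have b3 : μ.real (⋃ A : Finset (Fin n), ⋃ B : Finset (Fin m), {G | T A B ≤ edgeCount G A B}) ≤
      3 * Real.exp (-L) := by
    refine (measureReal_iUnion_fintype_le _).trans (le_trans ?_ (sum_exp_neg_card_le n m hL))
    refine Finset.sum_le_sum fun A _ => (measureReal_iUnion_fintype_le _).trans ?_
    refine Finset.sum_le_sum fun B _ =>
      (assignmentLaw_le_edgeCount hm hdm A B (le_max_left _ _)).trans ?_
    rw [Real.exp_le_exp]
    have := le_max_right (4 / 3 * ((d : ℝ) * A.card * B.card / m))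
      (48 * ((A.card : ℝ) + B.card + 1) * L)
    linarith
  refine (measureReal_mono hsub).trans ((measureReal_union_le _ _).trans ?_)
  have c1 := measureReal_union_le (μ := μ)
    (⋃ j : Fin m, {G | edgeCount G Finset.univ {j} ≤ 9 / 10 * meanDegree n m d})
    ((⋃ j : Fin m, {G | 2 * meanDegree n m d ≤ edgeCount G Finset.univ {j}}) ∪
      ⋃ A : Finset (Fin n), ⋃ B : Finset (Fin m), {G | T A B ≤ edgeCount G A B})
  have c2 := measureReal_union_le (μ := μ)
    (⋃ j : Fin m, {G | 2 * meanDegree n m d ≤ edgeCount G Finset.univ {j}})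
    (⋃ A : Finset (Fin n), ⋃ B : Finset (Fin m), {G | T A B ≤ edgeCount G A B})
  linarith

/-! ### Concentration of the score at the true merits -/

/-- The centred answer of the left vertex `e.1` on the right vertex `e.2`. -/
def noise (u : Subject n m → ℝ) (e : Fin n × Fin m) (w : Answers n m) : ℝ :=
  (if w e = true then 1 else 0) - Real.sigmoid (u (Sum.inl e.1) - u (Sum.inr e.2))

instance (u : Subject n m → ℝ) : IsProbabilityMeasure (answersLaw u) := by
  unfold answersLaw
  infer_instance

theorem iIndepFun_noise (u : Subject n m → ℝ) : iIndepFun (noise u) (answersLaw u) :=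
  iIndepFun_pi (X := fun (e : Fin n × Fin m) (b : Bool) =>
    (if b = true then (1 : ℝ) else 0) - Real.sigmoid (u (Sum.inl e.1) - u (Sum.inr e.2)))
    fun _ => (measurable_of_finite _).aemeasurable

theorem hasSubgaussianMGF_noise (u : Subject n m → ℝ) (e : Fin n × Fin m) :
    HasSubgaussianMGF (noise u e) (1 / 4) (answersLaw u) := by
  set X : Answers n m → ℝ := fun w => if w e = true then 1 else 0 with hX
  have h1 : (answersLaw u)[X] = Real.sigmoid (u (Sum.inl e.1) - u (Sum.inr e.2)) := by
    have h := integral_comp_eval (μ := fun e : Fin n × Fin m => bernoulliMeasure true false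
      (unitInterval.sigmoid (u (Sum.inl e.1) - u (Sum.inr e.2)))) (i := e)
      (f := fun b : Bool => if b = true then (1 : ℝ) else 0)
      (measurable_of_finite _).aestronglyMeasurable
    rw [integral_bernoulliMeasure] at h
    refine h.trans ?_
    simp only [if_true, Bool.false_eq_true, if_false, smul_eq_mul, mul_one, mul_zero, add_zero]
    rfl
  have h2 := hasSubgaussianMGF_of_mem_Icc (μ := answersLaw u) (X := X) (a := 0) (b := 1)
    (measurable_of_finite _).aemeasurable
    (ae_of_all _ fun w => by simp only [hX]; split_ifs <;> simp)
  rw [h1] at h2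
  have e4 : ((‖(1 : ℝ) - 0‖₊ / 2) ^ 2 : NNReal) = 1 / 4 := by
    rw [sub_zero, nnnorm_one]; norm_num
  rw [e4] at h2
  exact h2

/-- Hoeffding with variance proxy 1/4 per answer: the exponent is L|s| / (2|s|/4) = 2L. The
inequality in the event is strict so that empty `s` is harmless. -/
theorem answersLaw_noise_le (u : Subject n m → ℝ) (s : Finset (Fin n × Fin m)) {L : ℝ}
    (hL : 0 ≤ L) :
    (answersLaw u).real {w | Real.sqrt (L * s.card) < |∑ e ∈ s, noise u e w|} ≤
      2 * Real.exp (-(2 * L)) := by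
  rcases s.eq_empty_or_nonempty with rfl | hs
  · simp; positivity
  have hs' : (0 : ℝ) < s.card := by exact_mod_cast hs.card_pos
  have hc : -Real.sqrt (L * s.card) ^ 2 / (2 * ((∑ _ ∈ s, (1 / 4 : NNReal) : NNReal) : ℝ)) =
      -(2 * L) := by
    rw [Real.sq_sqrt (by positivity), Finset.sum_const, nsmul_eq_mul]
    push_cast
    field_simp
    norm_num
  have h1 := HasSubgaussianMGF.measure_sum_ge_le_of_iIndepFun (iIndepFun_noise u) (s := s)
    (fun e _ => hasSubgaussianMGF_noise u e) (Real.sqrt_nonneg (L * s.card))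
  have h2 := HasSubgaussianMGF.measure_sum_ge_le_of_iIndepFun
    ((iIndepFun_noise u).comp (fun _ x => -x) fun _ => measurable_neg) (s := s)
    (fun e _ => (hasSubgaussianMGF_noise u e).neg) (Real.sqrt_nonneg (L * s.card))
  rw [hc] at h1 h2
  rw [two_mul (Real.exp _)]
  refine le_trans ?_ (add_le_add h1 h2)
  refine le_trans (measureReal_mono ?_) (measureReal_union_le _ _)
  intro w hw
  rcases lt_abs.1 (Set.mem_ofPred_eq ▸ hw : Real.sqrt (L * s.card) < |_|) with h | h
  · exact Or.inl h.le
  · right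
    simp only [Set.mem_ofPred_eq, Function.comp_apply, Finset.sum_neg_distrib]
    exact h.le

theorem score_inl (ω : Assignment n m × Answers n m) (u : Subject n m → ℝ) (i : Fin n) :
    score ω u (Sum.inl i) = ∑ e ∈ {i} ×ˢ ω.1 i, noise u e ω.2 := by
  rw [Finset.sum_product, Finset.sum_singleton, score, Fintype.sum_sum_type]
  have h0 : ∑ a : Fin n, ((beats ω (Sum.inl i) (Sum.inl a) : ℝ) -
      link ω.1 (Sum.inl i) (Sum.inl a) * Real.sigmoid (u (Sum.inl i) - u (Sum.inl a))) = 0 := by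
    simp [beats, link]
  rw [h0, zero_add, ← Finset.univ_inter (ω.1 i), ← Finset.sum_ite_mem]
  refine Finset.sum_congr rfl fun j _ => ?_
  by_cases h : j ∈ ω.1 i <;> simp [beats, link, noise, h]

theorem score_inr (ω : Assignment n m × Answers n m) (u : Subject n m → ℝ) (j : Fin m) :
    score ω u (Sum.inr j) =
      -∑ e ∈ (Finset.univ.filter fun i => j ∈ ω.1 i) ×ˢ {j}, noise u e ω.2 := by
  rw [Finset.sum_product, score, Fintype.sum_sum_type]
  have h0 : ∑ a : Fin m, ((beats ω (Sum.inr j) (Sum.inr a) : ℝ) -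
      link ω.1 (Sum.inr j) (Sum.inr a) * Real.sigmoid (u (Sum.inr j) - u (Sum.inr a))) = 0 := by
    simp [beats, link]
  rw [h0, add_zero, Finset.sum_filter, ← Finset.sum_neg_distrib]
  refine Finset.sum_congr rfl fun i _ => ?_
  have e : u (Sum.inr j) - u (Sum.inl i) = -(u (Sum.inl i) - u (Sum.inr j)) := by ring
  rw [Finset.sum_singleton, e, Real.sigmoid_neg]
  by_cases h : j ∈ ω.1 i
  · cases h' : ω.2 (i, j) <;> simp [beats, link, noise, h, h']
  · simp [beats, link, h]

theorem answersLaw_score_le (G : Assignment n m) (u : Subject n m → ℝ) {L : ℝ} (hL : 0 ≤ L)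
    (a : Subject n m) :
    (answersLaw u).real {w | Real.sqrt (L * degree G a) < |score (G, w) u a|} ≤
      2 * Real.exp (-(2 * L)) := by
  rcases a with i | j
  · have h := answersLaw_noise_le u ({i} ×ˢ G i) hL
    simpa [score_inl, degree_inl] using h
  · have h := answersLaw_noise_le u ((Finset.univ.filter fun i => j ∈ G i) ×ˢ {j}) hL
    simpa [score_inr, degree_inr] using h

theorem answersLaw_exists_score_le (G : Assignment n m) (u : Subject n m → ℝ) {L : ℝ}
    (hL0 : 0 ≤ L) (hL : ((n : ℝ) + m) * Real.exp (-L) ≤ 1) :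
    (answersLaw u).real {w | ∃ a, Real.sqrt (L * degree G a) < |score (G, w) u a|} ≤
      2 * Real.exp (-L) := by
  rw [Set.ofPred_exists]
  refine (measureReal_iUnion_fintype_le _).trans ?_
  refine (Finset.sum_le_card_nsmul _ _ _ fun a _ => answersLaw_score_le G u hL0 a).trans ?_
  have e : Real.exp (-(2 * L)) = Real.exp (-L) * Real.exp (-L) := by
    rw [← Real.exp_add]; ring_nf
  rw [nsmul_eq_mul, Finset.card_univ, Fintype.card_sum, Fintype.card_fin, Fintype.card_fin, e]
  push_cast
  nlinarith [mul_le_mul_of_nonneg_right hL (Real.exp_pos (-L)).le]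

/-! ### Consistency on the good event -/

theorem meanDegree_le {d : ℕ} (hn : 0 < n) (hnm : n ≤ m) : meanDegree n m d ≤ d := by
  have hn' : (0 : ℝ) < n := by exact_mod_cast hn
  have hnm' : (n : ℝ) ≤ m := by exact_mod_cast hnm
  rw [meanDegree, div_le_iff₀ (hn'.trans_le hnm'), mul_comm]
  gcongr

theorem IsExpander.le_degree_subject {d : ℕ} {L : ℝ} {G : Assignment n m}
    (hG : IsExpander d L G) (hn : 0 < n) (hnm : n ≤ m) (a : Subject n m) :
    9 / 10 * meanDegree n m d ≤ degree G a := by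
  rcases a with i | j
  · have h0 : 0 ≤ meanDegree n m d := by rw [meanDegree]; positivity
    rw [degree_inl, hG.card_eq]
    linarith [meanDegree_le (d := d) hn hnm]
  · exact hG.le_degree j

/-- Differences of winning probabilities form a flow along the edges. -/
theorem sigmoid_sub_antisymm (u v : Subject n m → ℝ) (a b : Subject n m) :
    Real.sigmoid (v a - v b) - Real.sigmoid (u a - u b) =
      -(Real.sigmoid (v b - v a) - Real.sigmoid (u b - u a)) := by
  rw [← neg_sub (v a), ← neg_sub (u a), Real.sigmoid_neg, Real.sigmoid_neg]
  ring

theorem mul_sub_le_sigmoid_sub {R : ℝ} {u v : Subject n m → ℝ}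
    (hu : ∀ a b, |u a - u b| ≤ R) (hv : ∀ a b, |v a - v b| ≤ R) (a b : Subject n m)
    (h : v b - u b ≤ v a - u a) :
    Real.exp (-R) / 4 * ((v a - u a) - (v b - u b)) ≤
      Real.sigmoid (v a - v b) - Real.sigmoid (u a - u b) := by
  have := exp_neg_div_four_mul_sub_le_sigmoid_sub (hv a b) (hu a b) (by linarith)
  rwa [sub_sub_sub_comm (v a) (u a)]

theorem IsMLE.unique_of_isExpander {ω : Assignment n m × Answers n m} {d : ℕ} {L : ℝ}
    (hG : IsExpander d L ω.1) (hL : 0 < L) (hn : 0 < n) (hnm : n ≤ m)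
    (hlam : 1000 * L ≤ meanDegree n m d) {K : ℕ}
    (hK : (m : ℝ) ≤ (meanDegree n m d / (70 * L)) ^ K) {r : Subject n m}
    {v v' : Subject n m → ℝ} (hv : IsMLE ω r v) (hv' : IsMLE ω r v') : v' = v := by
  have hR : ∀ w : Subject n m → ℝ, ∀ a b, |w a - w b| ≤ 2 * ‖w‖ := by
    intro w a b
    have h1 := norm_le_pi_norm w a
    have h2 := norm_le_pi_norm w b
    have h3 := norm_sub_le (w a) (w b)
    rw [Real.norm_eq_abs] at h3
    linarith
  have hdiv : ∀ a, ∑ b, link ω.1 a b *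
      (Real.sigmoid (v' a - v' b) - Real.sigmoid (v a - v b)) = 0 := by
    intro a
    rw [score_sub_score, score_eq_zero_of_isMLE hv, score_eq_zero_of_isMLE hv', sub_zero]
  -- As the divergence is zero, the flow bound applies with every positive step `t`, however small
  -- the slope bound `c` obtained from the norms of the two MLEs.
  have key : ∀ a b, (v' a - v a) - (v' b - v b) ≤ 0 := by
    intro a b
    refine le_of_forall_pos_le_add fun η hη => ?_
    have hK0 : (0 : ℝ) < 2 * (K + 1) := by positivity
    have hnn : ∀ x, 0 ≤ Real.exp (-(2 * ‖v‖ + 2 * ‖v'‖)) / 4 * (η / (2 * (K + 1))) / 30 *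
        degree ω.1 x := fun x => mul_nonneg (by positivity) (degree_nonneg _ _)
    have := hG.sub_le_of_flow hL hn hnm hlam hK (δ := fun a => v' a - v a)
      (F := fun a b => Real.sigmoid (v' a - v' b) - Real.sigmoid (v a - v b))
      (c := Real.exp (-(2 * ‖v‖ + 2 * ‖v'‖)) / 4) (t := η / (2 * (K + 1)))
      (by positivity) (by positivity) (sigmoid_sub_antisymm v v')
      (mul_sub_le_sigmoid_sub (fun a b => (hR v a b).trans (by linarith [norm_nonneg v']))
        fun a b => (hR v' a b).trans (by linarith [norm_nonneg v]))
      (fun x _ => by rw [hdiv]; exact hnn x)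
      (fun x _ => by rw [hdiv]; linarith [hnn x]) a b
    rw [mul_div_cancel₀ _ hK0.ne'] at this
    linarith
  funext a
  have h1 := key a r
  have h2 := key r a
  rw [hv.1, hv'.1] at h1 h2
  linarith

/-- The deterministic core. Since ε ≤ 1, the constrained maximizer has merit range at most α + 1,
whence the slope e^{-(α+1)}/4. `hLt` makes the noise small against the flow, and `hKt` makes the
constraint inactive. -/
theorem isMLE_near_of_isExpander {ω : Assignment n m × Answers n m} {d : ℕ} {L : ℝ}
    (hG : IsExpander d L ω.1) (hL : 0 < L) (hn : 0 < n) (hnm : n ≤ m)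
    (hlam : 1000 * L ≤ meanDegree n m d) {K : ℕ}
    (hK : (m : ℝ) ≤ (meanDegree n m d / (70 * L)) ^ K) {r : Subject n m}
    {u : Subject n m → ℝ} (hur : u r = 0)
    (hscore : ∀ a, |score ω u a| ≤ Real.sqrt (L * degree ω.1 a))
    {α ε t : ℝ} (hα : ∀ a b, |u a - u b| ≤ α) (hε : 0 < ε) (hε1 : ε ≤ 1) (ht : 0 < t)
    (hLt : Real.sqrt (L / (9 / 10 * meanDegree n m d)) ≤ Real.exp (-(α + 1)) / 4 * t / 30)
    (hKt : 2 * (K + 1) * t < ε) :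
    (∃! v, IsMLE ω r v) ∧ ∀ v, IsMLE ω r v → ‖v - u‖ ≤ ε := by
  obtain ⟨v, hvr, hosc, hpos, hneg, hzero⟩ := exists_constrained_maximizer ω r u hur hε
  have hlam0 : 0 < meanDegree n m d := by linarith
  have hS : ∀ a, |score ω u a| ≤ Real.exp (-(α + 1)) / 4 * t / 30 * degree ω.1 a := by
    intro a
    have hdeg := hG.le_degree_subject hn hnm a
    have hdeg0 : 0 < degree ω.1 a := by linarith
    refine (hscore a).trans ?_
    have e : L * degree ω.1 a = L / degree ω.1 a * degree ω.1 a ^ 2 := by field_simp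
    rw [e, Real.sqrt_mul (by positivity), Real.sqrt_sq hdeg0.le]
    refine mul_le_mul_of_nonneg_right (le_trans ?_ hLt) hdeg0.le
    gcongr
  have hv : ∀ a b, |v a - v b| ≤ α + 1 := by
    intro a b
    have h1 := abs_le.1 (hα a b)
    have h2 := hosc a b
    have h3 := hosc b a
    rw [abs_le]
    constructor <;> linarith
  have hflow := hG.sub_le_of_flow hL hn hnm hlam hK (δ := fun a => v a - u a)
    (F := fun a b => Real.sigmoid (v a - v b) - Real.sigmoid (u a - u b))
    (c := Real.exp (-(α + 1)) / 4) (by positivity) ht (sigmoid_sub_antisymm u v)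
    (mul_sub_le_sigmoid_sub (fun a b => (hα a b).trans (by linarith)) hv)
    (fun a ha => by
      rw [score_sub_score]
      linarith [hpos a ha, (abs_le.1 (hS a)).2])
    (fun a ha => by
      rw [score_sub_score]
      linarith [hneg a ha, (abs_le.1 (hS a)).1])
  have hMLE : IsMLE ω r v :=
    isMLE_of_score_eq_zero hvr (hzero fun a b => (hflow a b).trans_lt hKt)
  have huniq : ∀ v', IsMLE ω r v' → v' = v := fun v' hv' =>
    hMLE.unique_of_isExpander hG hL hn hnm hlam hK hv'
  refine ⟨⟨v, hMLE, huniq⟩, fun v' hv' => ?_⟩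
  rw [huniq v' hv', pi_norm_le_iff_of_nonneg hε.le]
  intro a
  have h1 := hosc a r
  have h2 := hosc r a
  rw [hvr, hur] at h1 h2
  rw [Real.norm_eq_abs, Pi.sub_apply, abs_le]
  constructor <;> linarith

theorem examLaw_isMLE_ge {d : ℕ} {L : ℝ} (hL : 0 < L) (hn : 0 < n) (hnm : n ≤ m) (hd : 1 ≤ d)
    (hdm : d ≤ m) (hNL : ((n : ℝ) + m) * Real.exp (-L) ≤ 1)
    (hlam : 1000 * L ≤ meanDegree n m d) {K : ℕ}
    (hK : (m : ℝ) ≤ (meanDegree n m d / (70 * L)) ^ K) {r : Subject n m}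
    {u : Subject n m → ℝ} (hur : u r = 0)
    {α ε t : ℝ} (hα : ∀ a b, |u a - u b| ≤ α) (hε : 0 < ε) (hε1 : ε ≤ 1) (ht : 0 < t)
    (hLt : Real.sqrt (L / (9 / 10 * meanDegree n m d)) ≤ Real.exp (-(α + 1)) / 4 * t / 30)
    (hKt : 2 * (K + 1) * t < ε) :
    ENNReal.ofReal (1 - 7 * Real.exp (-L)) ≤
      examLaw d u {ω | (∃! v, IsMLE ω r v) ∧ ∀ v, IsMLE ω r v → ‖v - u‖ ≤ ε} := by
  have := isProbabilityMeasure_assignmentLaw (n := n) hdm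
  have : IsProbabilityMeasure (examLaw d u) := by unfold examLaw; infer_instance
  set E := {ω : Assignment n m × Answers n m |
    (∃! v, IsMLE ω r v) ∧ ∀ v, IsMLE ω r v → ‖v - u‖ ≤ ε} with hE
  set B₁ := {G : Assignment n m | ¬ IsExpander d L G} with hB₁
  set B₂ := {ω : Assignment n m × Answers n m |
    ∃ a, Real.sqrt (L * degree ω.1 a) < |score ω u a|} with hB₂
  have hsub : Eᶜ ⊆ (B₁ ×ˢ Set.univ) ∪ B₂ := by
    intro ω hω
    by_contra hcon
    rw [Set.mem_union, not_or] at hcon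
    have h1 : IsExpander d L ω.1 := by
      by_contra h
      exact hcon.1 ⟨h, Set.mem_univ _⟩
    have h2 : ∀ a, |score ω u a| ≤ Real.sqrt (L * degree ω.1 a) := by
      intro a
      by_contra h
      exact hcon.2 ⟨a, not_le.1 h⟩
    exact hω (isMLE_near_of_isExpander h1 hL hn hnm hlam hK hur h2 hα hε hε1 ht hLt hKt)
  have h1 : examLaw d u (B₁ ×ˢ Set.univ) ≤ ENNReal.ofReal (5 * Real.exp (-L)) := by
    rw [examLaw, Measure.prod_prod, measure_univ, mul_one]
    rw [← ofReal_measureReal (measure_ne_top _ _)]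
    exact ENNReal.ofReal_le_ofReal
      (assignmentLaw_not_isExpander_le (hn.trans_le hnm) hd hdm hL hNL hlam)
  have h2 : examLaw d u B₂ ≤ ENNReal.ofReal (2 * Real.exp (-L)) := by
    -- Given the graph the score is a sum of independent terms, and the bound is uniform in the
    -- graph, so it survives integration.
    rw [examLaw, Measure.prod_apply (Set.toFinite _).measurableSet]
    refine (lintegral_mono fun G => ?_).trans_eq ((lintegral_const _).trans (by
      rw [measure_univ, mul_one]))
    rw [← ofReal_measureReal (measure_ne_top _ _)]
    exact ENNReal.ofReal_le_ofReal (answersLaw_exists_score_le G u hL.le hNL)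
  have hc : examLaw d u Eᶜ ≤ ENNReal.ofReal (7 * Real.exp (-L)) := by
    refine (measure_mono hsub).trans ((measure_union_le _ _).trans ((add_le_add h1 h2).trans_eq ?_))
    rw [← ENNReal.ofReal_add (by positivity) (by positivity)]
    congr 1
    ring
  rw [prob_compl_eq_one_sub (Set.toFinite _).measurableSet, tsub_le_iff_right] at hc
  rw [ENNReal.ofReal_sub _ (by positivity), ENNReal.ofReal_one, tsub_le_iff_right, add_comm]
  exact hc

/-! ### Asymptotics of the parameters -/

theorem abs_sub_le_meritRange (u : Subject n m → ℝ) (a b : Subject n m) :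
    |u a - u b| ≤ meritRange u := by
  have h : ∀ a b, u a - u b ≤ meritRange u := fun a b =>
    le_ciSup (f := fun p : Subject n m × Subject n m => u p.1 - u p.2)
      (Set.finite_range _).bddAbove (a, b)
  rw [abs_le]
  constructor <;> linarith [h a b, h b a]

theorem delta_eq (n m d : ℕ) (hm : 0 < m) (hn : 0 < n) (hd : 1 ≤ d) :
    delta n m d = Real.sqrt (Real.log (n + m) ^ 3 /
      (meanDegree n m d * Real.log (meanDegree n m d) ^ 2)) := by
  have h : (n / m * d : ℝ) = meanDegree n m d := by rw [meanDegree]; ring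
  rw [delta, h]
  congr 1
  have : (0 : ℝ) < m := by exact_mod_cast hm
  have : (0 : ℝ) < n := by exact_mod_cast hn
  have : (0 : ℝ) < d := by exact_mod_cast hd
  set l := Real.log (meanDegree n m d)
  rw [meanDegree]
  rcases eq_or_ne l 0 with hl | hl
  · simp [hl]
  · field_simp

/-- A number `x` with `L ^ 3 ≤ x * log x ^ 2` is far larger than `L ^ 2`. -/
theorem eventually_mul_sq_le_of_cube_le :
    ∀ᶠ L : ℝ in atTop, ∀ x : ℝ, 0 < x → L ^ 3 ≤ x * Real.log x ^ 2 →
      1 < x ∧ 4900 * L ^ 2 ≤ x := by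
  have ho := (Real.isLittleO_pow_log_id_atTop (n := 2)).bound
    (show (0 : ℝ) < 1 / 50000 by norm_num)
  filter_upwards [ho, eventually_ge_atTop 4900] with L hL hL' x hx h
  -- The squared logarithm does not see whether x < 1, but there x log² x = 4(√x log √x)² < 4, which
  -- is too small.
  have hx1 : 1 < x := by
    by_contra! hx1
    have h1 := Real.abs_log_mul_self_lt (Real.sqrt x) (Real.sqrt_pos.2 hx)
      (Real.sqrt_le_one.2 hx1)
    have h2 : (Real.log (Real.sqrt x) * Real.sqrt x) ^ 2 < 1 := by
      rw [← sq_abs]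
      exact pow_lt_one₀ (abs_nonneg _) h1 (by norm_num)
    rw [mul_pow, Real.sq_sqrt hx.le, Real.log_sqrt hx.le] at h2
    have h3 : (4900 : ℝ) ^ 3 ≤ L ^ 3 := by gcongr
    nlinarith
  refine ⟨hx1, ?_⟩
  -- Otherwise log x ≤ 3 log L, and x log² x is at most 4900·9/50000 < 1 times L³.
  by_contra! hlt
  have hlog0 : 0 < Real.log x := Real.log_pos hx1
  have hlog : Real.log x ≤ 3 * Real.log L := by
    rw [← Real.log_rpow (by linarith)]
    refine Real.log_le_log hx (hlt.le.trans ?_)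
    norm_num
    nlinarith [sq_nonneg L]
  have hsq : Real.log x ^ 2 ≤ 9 * Real.log L ^ 2 := by nlinarith
  simp only [id, Real.norm_eq_abs, abs_pow, sq_abs] at hL
  rw [abs_of_nonneg (by linarith : (0 : ℝ) ≤ L)] at hL
  have hL0 : (0 : ℝ) < L := by linarith
  have h4 : x * Real.log x ^ 2 ≤ 4900 * L ^ 2 * (9 * (1 / 50000 * L)) := by
    apply mul_le_mul hlt.le _ (by positivity) (by positivity)
    linarith
  nlinarith [pow_pos hL0 3]

/-- Since 4900 = 70², the hypothesis says 70L ≤ √x, so the growth factor is at least √x = e^{(log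
x)/2}, and 2L/log x steps reach e^L. -/
theorem le_pow_ceil {x L N : ℝ} (hx : 1 < x) (hL : 0 < L) (hxL : 4900 * L ^ 2 ≤ x)
    (hN : N ≤ Real.exp L) : N ≤ (x / (70 * L)) ^ ⌈2 * L / Real.log x⌉₊ := by
  have hlog : 0 < Real.log x := Real.log_pos hx
  have h1 : Real.sqrt x ≤ x / (70 * L) := by
    rw [le_div_iff₀ (by positivity)]
    have h70 : 70 * L ≤ Real.sqrt x := Real.le_sqrt_of_sq_le (by linarith)
    nlinarith [Real.sq_sqrt (by linarith : (0 : ℝ) ≤ x), Real.sqrt_nonneg x]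
  have h2 : Real.sqrt x = Real.exp (Real.log x / 2) := by
    rw [← Real.log_sqrt (by linarith), Real.exp_log (Real.sqrt_pos.2 (by linarith))]
  calc N ≤ Real.exp L := hN
    _ ≤ Real.exp (⌈2 * L / Real.log x⌉₊ * (Real.log x / 2)) := by
        rw [Real.exp_le_exp]
        have := Nat.le_ceil (2 * L / Real.log x)
        rw [div_le_iff₀ hlog] at this
        linarith
    _ = Real.sqrt x ^ ⌈2 * L / Real.log x⌉₊ := by rw [Real.exp_nat_mul, h2]
    _ ≤ _ := by gcongr

end Rasch

end

open Rasch in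
theorem mainTheorem1
    (n m d : ℕ → ℕ)
    (hn : Tendsto n atTop atTop)
    (hm : Tendsto m atTop atTop)
    (hnm : ∀ k, n k ≤ m k)
    (hd_pos : ∀ k, 1 ≤ d k)
    (hd_le : ∀ k, d k ≤ m k)
    (hnd : ∀ k, n k * d k ≠ m k)
    (u : ∀ k, Subject (n k) (m k) → ℝ)
    (r : ∀ k, Subject (n k) (m k))
    (hu : ∀ k, u k (r k) = 0)
    (hcond : Tendsto
      (fun k => Real.exp (2 * (meritRange (u k) + 1)) * delta (n k) (m k) (d k))
      atTop (𝓝 0)) :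
    ∀ ε : ℝ, 0 < ε →
      Tendsto
        (fun k => examLaw (d k) (u k)
          {ω | (∃! v, IsMLE ω (r k) v) ∧ ∀ v, IsMLE ω (r k) v → ‖v - u k‖ ≤ ε})
        atTop (𝓝 1) := by
  intro ε hε
  -- The cap at 1 keeps the candidates within merit range α + 1.
  set ε' := min ε 1 with hε'
  have hε'0 : 0 < ε' := lt_min hε one_pos
  have hNtop : Tendsto (fun k => (n k : ℝ) + m k) atTop atTop :=
    (tendsto_natCast_atTop_atTop.comp hn).atTop_add_nonneg fun k => Nat.cast_nonneg _
  have hLtop : Tendsto (fun k => Real.log ((n k : ℝ) + m k)) atTop atTop :=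
    Real.tendsto_log_atTop.comp hNtop
  have hlim : Tendsto (fun k => ENNReal.ofReal
      (1 - 7 * Real.exp (-Real.log ((n k : ℝ) + m k)))) atTop (𝓝 1) := by
    have h1 : Tendsto (fun k => 1 - 7 * Real.exp (-Real.log ((n k : ℝ) + m k))) atTop
        (𝓝 (1 - 7 * 0)) :=
      ((Real.tendsto_exp_neg_atTop_nhds_zero.comp hLtop).const_mul 7).const_sub 1
    simpa using ENNReal.tendsto_ofReal h1
  refine tendsto_of_tendsto_of_tendsto_of_le_of_le' hlim tendsto_const_nhds ?_ ?_
  swap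
  · refine Eventually.of_forall fun k => ?_
    have := isProbabilityMeasure_assignmentLaw (n := n k) (hd_le k)
    have : IsProbabilityMeasure (examLaw (d k) (u k)) := by unfold examLaw; infer_instance
    exact prob_le_one
  filter_upwards [hn.eventually_ge_atTop 1, hLtop.eventually eventually_mul_sq_le_of_cube_le,
    hLtop.eventually_ge_atTop 1,
    hcond.eventually_lt_const (show (0 : ℝ) < ε' / 1056 by positivity)] with k hnk hgrow hL1 hΔ
  have hmk : 0 < m k := (by omega : 0 < n k).trans_le (hnm k)
  have hn' : (0 : ℝ) < n k := by exact_mod_cast hnk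
  have hm' : (0 : ℝ) < m k := by exact_mod_cast hmk
  have hd' : (0 : ℝ) < d k := by exact_mod_cast hd_pos k
  set α := meritRange (u k) with hα
  set L := Real.log ((n k : ℝ) + m k) with hL
  set x := meanDegree (n k) (m k) (d k) with hx
  have hα0 : 0 ≤ α := (abs_nonneg _).trans (abs_sub_le_meritRange (u k) (r k) (r k))
  have hx0 : 0 < x := by rw [hx, meanDegree]; positivity
  -- Without nd ≠ m the logarithm could vanish, and division by zero would give `delta` the value 0
  -- and no information.
  have hx1 : x ≠ 1 := by
    rw [hx, meanDegree, Ne, div_eq_one_iff_eq hm'.ne']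
    exact_mod_cast hnd k
  have hlogne : Real.log x ≠ 0 := Real.log_ne_zero_of_pos_of_ne_one hx0 hx1
  have hden : 0 < x * Real.log x ^ 2 := by positivity
  have hκ : 1 ≤ Real.exp (α + 1) := Real.one_le_exp (by linarith)
  have hκ2 : Real.exp (2 * (α + 1)) = Real.exp (α + 1) * Real.exp (α + 1) := by
    rw [← Real.exp_add]; ring_nf
  have hδ := delta_eq (n k) (m k) (d k) hmk hnk (hd_pos k)
  rw [← hx, ← hL] at hδ
  have hΔ0 : 0 ≤ delta (n k) (m k) (d k) := Real.sqrt_nonneg _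
  -- Only the first power of e^{α+1} is needed; the hypothesis provides its square.
  have hκΔ : Real.exp (α + 1) * delta (n k) (m k) (d k) < ε' / 1056 := by
    refine lt_of_le_of_lt ?_ hΔ
    rw [hκ2]
    gcongr
    exact le_mul_of_one_le_left (by linarith) hκ
  have hcube : L ^ 3 ≤ x * Real.log x ^ 2 := by
    have h1 : delta (n k) (m k) (d k) ≤ 1 := by
      have := le_mul_of_one_le_left hΔ0 hκ
      have := min_le_right ε 1
      linarith
    rw [hδ, Real.sqrt_le_one, div_le_one hden] at h1
    exact h1
  obtain ⟨hx1', hxL⟩ := hgrow x hx0 hcube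
  have hL0 : 0 < L := by linarith
  have hlog : 0 < Real.log x := Real.log_pos hx1'
  have hexpL : Real.exp L = n k + m k := Real.exp_log (by positivity)
  have hdelta : delta (n k) (m k) (d k) = L / Real.log x * Real.sqrt (L / x) := by
    rw [hδ]
    have e : L ^ 3 / (x * Real.log x ^ 2) = (L / Real.log x) ^ 2 * (L / x) := by field_simp
    rw [e, Real.sqrt_mul (by positivity), Real.sqrt_sq (by positivity)]
  have hlogL : Real.log x ≤ L := by
    refine Real.log_le_log hx0 ?_
    rw [hx, meanDegree, div_le_iff₀ hm']
    have : (d k : ℝ) ≤ m k := by exact_mod_cast hd_le k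
    nlinarith
  set K := ⌈2 * L / Real.log x⌉₊ with hK
  have hKle : (K : ℝ) ≤ 2 * (L / Real.log x) + 1 := by
    have := (Nat.ceil_lt_add_one (show 0 ≤ 2 * L / Real.log x by positivity)).le
    linarith [mul_div_assoc 2 L (Real.log x)]
  have hratio : 1 ≤ L / Real.log x := by rwa [one_le_div hlog]
  have hsqrt : Real.sqrt (L / (9 / 10 * x)) ≤ 11 / 10 * Real.sqrt (L / x) := by
    refine Real.sqrt_le_iff.2 ⟨by positivity, ?_⟩
    rw [mul_pow, Real.sq_sqrt (by positivity)]
    have e : L / (9 / 10 * x) = 10 / 9 * (L / x) := by field_simp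
    rw [e]
    gcongr
    norm_num
  -- The step `t` is the least allowed by the noise bound: 132 = 4·30·(11/10), where 11/10 bounds
  -- √(10/9). As K + 1 ≤ 4L/log x, the total 2(K+1)t is at most 8·132 = 1056 times e^{α+1}Δ.
  have hmain := examLaw_isMLE_ge (n := n k) (m := m k) (d := d k) (L := L) (K := K) (r := r k)
    (u := u k) (α := α) (ε := ε') (t := 132 * Real.exp (α + 1) * Real.sqrt (L / x))
    hL0 hnk (hnm k) (hd_pos k) (hd_le k)
    (by rw [← hexpL, ← Real.exp_add]; simp)
    (by nlinarith)
    (le_pow_ceil hx1' hL0 hxL (by rw [hexpL]; linarith))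
    (hu k) (abs_sub_le_meritRange (u k)) hε'0 (min_le_right _ _) (by positivity)
    (by
      refine hsqrt.trans (le_of_eq ?_)
      have : Real.exp (-(α + 1)) * Real.exp (α + 1) = 1 := by rw [← Real.exp_add]; simp
      linear_combination (-11 / 10 * Real.sqrt (L / x)) * this)
    (by
      calc 2 * ((K : ℝ) + 1) * (132 * Real.exp (α + 1) * Real.sqrt (L / x))
          ≤ (8 * (L / Real.log x)) * (132 * Real.exp (α + 1) * Real.sqrt (L / x)) := by
            refine mul_le_mul_of_nonneg_right ?_ (by positivity)
            linarith
        _ = 1056 * (Real.exp (α + 1) * delta (n k) (m k) (d k)) := by rw [hdelta]; ring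
        _ < ε' := by linarith)
  refine hmain.trans (measure_mono fun ω hω => ⟨hω.1, fun v hv => ?_⟩)
  exact (hω.2 v hv).trans (min_le_left _ _)
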